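/- **Setting.** Let $H$ be a separable complex Hilbert space, $A: D(A)\subset H\to H$ a selfadjoint operator, $a<b$ real numbers, and $L^2=L^2(H,(-\infty,a))\oplus L^2(H,(b,\infty))$. Let $\tilde A: H\to H_-$ be the extension of $A$ to an operator from $H$ into the (anti)dual $H_-$ of $D(A)$ with its graph norm, i.e. $(\tilde A h)(x)=\langle Ax,h\rangle$ for $x\in D(A)$. The maximal operator $L$ in $L^2$ acts by $L(u_1,u_2)=(iu_1'+\tilde Au_1,\,iu_2'+\tilde Au_2)$ on all $u=(u_1,u_2)\in L^2$ for which $iu_1'+\tilde Au_1$ and $iu_2'+\tilde Au_2$, with derivatives in the sense of $H_-$-valued distributions, are square integrable $H$-valued functions. For a unitary operator $W$ in $H$, $L_W$ is the restriction of $L$ to all $u\in D(L)$ whose components have representatives that are continuous up to the end points $a$ and $b$ and satisfy $u_2(b)=Wu_1(a)$. **Theorem 3.2.** The operator $iA$ generates exactly one strongly continuous unitary group $(e^{i\tau A})_{\tau\in\mathbb R}$; put $e^{-i(\lambda-\tilde A)\tau}=e^{-i\lambda\tau}e^{i\tau A}$ on $H$. For every unitary $W$ in $H$, $$\rho(L_W)\supset\{\lambda\in\mathbb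 C:\ \operatorname{Im}\lambda\ne 0\}.$$ Moreover, for $f=(f_1,f_2)\in L^2$ and $\lambda_i=\operatorname{Im}\lambda\neq 0$, the function $u=(L_W-\lambda)^{-1}f$ is given almost everywhere by the following formulas, in which all integrals converge absolutely (also at the end points $t=b$ and $t=a$ used in $f_\lambda^*$ and $g_\lambda^*$). (i) If $\lambda_i>0$: $$u_1(t)=e^{-i(\lambda-\tilde A)(t-a)}f_\lambda^*+i\int_t^a e^{-i(\lambda-\tilde A)(t-s)}f_1(s)\,ds\quad(t<a),$$ $$u_2(t)=i\int_t^\infty e^{-i(\lambda-\tilde A)(t-s)}f_2(s)\,ds\quad(t>b),\qquad f_\lambda^*=W^*\Big(i\int_b^\infty e^{-i(\lambda-\tilde A)(b-s)}f_2(s)\,ds\Big).$$ The function $u_2$ and both terms of $u_1$ are square integrable, and $$\|f_\lambda^*\|_H^2\le\frac1{2\lambda_i}\|f_2\|^2,\qquad \int_{-\infty}^a\big\|e^{-i(\lambda-\tilde A)(t-a)}f_\lambda^*\big\|_H^2dt=\frac1{2\lambda_i}\|f_\lambda^*\|_H^2,$$ $$\int_{-\infty}^a\Big\|i\int_t^a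 e^{-i(\lambda-\tilde A)(t-s)}f_1(s)ds\Big\|_H^2dt\le\frac1{\lambda_i^2}\|f_1\|^2,\qquad \int_b^\infty\Big\|i\int_t^\infty e^{-i(\lambda-\tilde A)(t-s)}f_2(s)ds\Big\|_H^2dt\le\frac1{\lambda_i^2}\|f_2\|^2 .$$ (ii) If $\lambda_i<0$: $$u_1(t)=-i\int_{-\infty}^t e^{-i(\lambda-\tilde A)(t-s)}f_1(s)\,ds\quad(t<a),$$ $$u_2(t)=e^{-i(\lambda-\tilde A)(t-b)}g_\lambda^*-i\int_b^t e^{-i(\lambda-\tilde A)(t-s)}f_2(s)\,ds\quad(t>b),\qquad g_\lambda^*=W\Big(-i\int_{-\infty}^a e^{-i(\lambda-\tilde A)(a-s)}f_1(s)\,ds\Big).$$ The function $u_1$ and both terms of $u_2$ are square integrable, and $$\int_{-\infty}^a\Big\|-i\int_{-\infty}^t e^{-i(\lambda-\tilde A)(t-s)}f_1(s)ds\Big\|_H^2dt\le\frac1{|\lambda_i|^2}\|f_1\|^2,\qquad \|g_\lambda^*\|_H^2\le\frac1{2|\lambda_i|}\|f_1\|^2,$$ $$\int_b^\infty\big\|e^{-i(\lambda-\tilde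 A)(t-b)}g_\lambda^*\big\|_H^2dt=\frac1{2|\lambda_i|}\|g_\lambda^*\|_H^2\le\frac1{4|\lambda_i|^2}\|f_1\|^2,$$ $$\int_b^\infty\Big\|-i\int_b^t e^{-i(\lambda-\tilde A)(t-s)}f_2(s)ds\Big\|_H^2dt\le\frac1{|\lambda_i|^2}\|f_2\|^2 .$$ Here $\|f_1\|$ and $\|f_2\|$ are the norms in $L^2(H,(-\infty,a))$ and $L^2(H,(b,\infty))$. -/

import Mathlib

open MeasureTheory Set
open scoped ContDiff InnerProductSpace

namespace SingularDiff

noncomputable section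

/-- The space `L²(H, J)` of square integrable `H`-valued functions on `J ⊆ ℝ`. -/
abbrev L2On (H : Type*) [NormedAddCommGroup H] (J : Set ℝ) : Type _ :=
  Lp H 2 (volume.restrict J)

/-- The Hilbert space `L² = L²(H, (-∞, a)) ⊕ L²(H, (b, ∞))`; the two components of `u` are
`u.fst` and `u.snd`. -/
abbrev L2Sum (H : Type*) [NormedAddCommGroup H] (a b : ℝ) : Type _ :=
  WithLp 2 (L2On H (Iio a) × L2On H (Ioi b))

section MaximalOperator

variable {H : Type*} [NormedAddCommGroup H] [InnerProductSpace ℂ H]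

theorem integrable_mul_inner {J : Set ℝ} {c : ℝ → ℝ} (hc : Continuous c)
    (hs : HasCompactSupport c) (x : H) (u : L2On H J) :
    Integrable (fun t => (c t : ℂ) * ⟪x, u t⟫_ℂ) (volume.restrict J) := by
  have h1 : MemLp (fun t => ⟪x, u t⟫_ℂ) 2 (volume.restrict J) := (Lp.memLp u).const_inner x
  have h2 : MemLp (fun t => (c t : ℂ)) 2 (volume.restrict J) :=
    (Complex.continuous_ofReal.comp hc).memLp_of_hasCompactSupport
      (hs.comp_left Complex.ofReal_zero)
  exact h2.integrable_mul h1

theorem integral_mul_inner_add {J : Set ℝ} {c : ℝ → ℝ} (hc : Continuous c)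
    (hs : HasCompactSupport c) (x : H) (u v : L2On H J) :
    ∫ t in J, (c t : ℂ) * ⟪x, (u + v : L2On H J) t⟫_ℂ
      = (∫ t in J, (c t : ℂ) * ⟪x, u t⟫_ℂ) + ∫ t in J, (c t : ℂ) * ⟪x, v t⟫_ℂ := by
  rw [← integral_add (integrable_mul_inner hc hs x u) (integrable_mul_inner hc hs x v)]
  apply integral_congr_ae
  filter_upwards [Lp.coeFn_add u v] with t ht
  rw [ht, Pi.add_apply, inner_add_right, mul_add]

theorem integral_mul_inner_smul {J : Set ℝ} (c : ℝ → ℝ) (x : H) (k : ℂ) (u : L2On H J) :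
    ∫ t in J, (c t : ℂ) * ⟪x, (k • u : L2On H J) t⟫_ℂ
      = k * ∫ t in J, (c t : ℂ) * ⟪x, u t⟫_ℂ := by
  rw [← integral_const_mul]
  apply integral_congr_ae
  filter_upwards [Lp.coeFn_smul k u] with t ht
  rw [ht, Pi.smul_apply, inner_smul_right]
  ring

/-- `IsWeakSolution A J u g` says that `i u' + Ã u = g` on `J`, where `Ã : H → H₋` is the extension
of `A` to an operator into the negative space `H₋`, the (anti)dual of `H₊ = D(A)` with the graph
norm: `Ã h` is the functional `x ↦ ⟪A x, h⟫` on `D(A)`. The derivative is the distributional one,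
so the equation is tested against `φ(t) x`, with `φ ∈ C_c^∞(J)` and `x ∈ D(A)`. -/
def IsWeakSolution (A : H →ₗ.[ℂ] H) (J : Set ℝ) (u g : L2On H J) : Prop :=
  ∀ φ : ℝ → ℝ, ContDiff ℝ ∞ φ → HasCompactSupport φ → tsupport φ ⊆ J → ∀ x : A.domain,
    -Complex.I * (∫ t in J, ((deriv φ t : ℝ) : ℂ) * ⟪(x : H), u t⟫_ℂ)
        + ∫ t in J, (φ t : ℂ) * ⟪A x, u t⟫_ℂ
      = ∫ t in J, (φ t : ℂ) * ⟪(x : H), g t⟫_ℂ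

/-- The graph `{(u, g) | i u' + Ã u = g}` of the maximal operator in `L²(H, J)`. -/
def maxGraph (A : H →ₗ.[ℂ] H) (J : Set ℝ) : Submodule ℂ (L2On H J × L2On H J) where
  carrier := {p | IsWeakSolution A J p.1 p.2}
  zero_mem' := by
    intro φ hφ hs hJ x
    have h0 : ∀ (c : ℝ → ℝ) (y : H),
        ∫ t in J, (c t : ℂ) * ⟪y, (0 : L2On H J) t⟫_ℂ = 0 := by
      intro c y
      have h := integral_mul_inner_smul c y 0 (0 : L2On H J)
      simpa using h
    simp only [Prod.fst_zero, Prod.snd_zero]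
    rw [h0 (deriv φ), h0 φ, h0 φ]
    simp
  add_mem' := by
    rintro p q hp hq φ hφ hs hJ x
    have hd : Continuous (deriv φ) := hφ.continuous_deriv (by simp)
    have h1 := hp φ hφ hs hJ x
    have h2 := hq φ hφ hs hJ x
    simp only [Prod.fst_add, Prod.snd_add]
    rw [integral_mul_inner_add hd hs.deriv, integral_mul_inner_add hφ.continuous hs,
      integral_mul_inner_add hφ.continuous hs, ← h1, ← h2]
    ring
  smul_mem' := by
    rintro k p hp φ hφ hs hJ x
    have h1 := hp φ hφ hs hJ x
    simp only [Prod.smul_fst, Prod.smul_snd]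
    rw [integral_mul_inner_smul (deriv φ), integral_mul_inner_smul φ,
      integral_mul_inner_smul φ, ← h1]
    ring

/-- The maximal operator generated by `i d/dt + Ã` in `L²(H, J)`: its domain consists of all
`u ∈ L²(H, J)` with `i u' + Ã u ∈ L²(H, J)`. -/
def maxOp (A : H →ₗ.[ℂ] H) (J : Set ℝ) : L2On H J →ₗ.[ℂ] L2On H J :=
  (maxGraph A J).toLinearPMap

theorem maxGraph_singleValued [CompleteSpace H] {A : H →ₗ.[ℂ] H}
    (hA : Dense (A.domain : Set H)) {J : Set ℝ} (hJ : IsOpen J)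
    (p : L2On H J × L2On H J) (hp : p ∈ maxGraph A J) (h0 : p.1 = 0) : p.2 = 0 := by
  obtain ⟨u, g⟩ := p
  simp only at h0 ⊢
  subst h0
  have hloc : LocallyIntegrableOn g J volume := by
    have h : LocallyIntegrable g (volume.restrict J) := (Lp.memLp g).locallyIntegrable (by norm_num)
    exact locallyIntegrableOn_of_locallyIntegrable_restrict h
  have key := hJ.ae_eq_zero_of_integral_contDiff_smul_eq_zero hloc (by
    intro φ hφ hs hsJ
    have hint : Integrable (fun t => φ t • g t) (volume.restrict J) := by
      have h2 : MemLp φ 2 (volume.restrict J) :=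
        hφ.continuous.memLp_of_hasCompactSupport hs
      have h3 : MemLp (φ • (g : ℝ → H)) 1 (volume.restrict J) := (Lp.memLp g).smul h2
      exact memLp_one_iff_integrable.1 h3
    have hres : ∫ t, φ t • g t = ∫ t in J, φ t • g t := by
      symm
      apply setIntegral_eq_integral_of_forall_compl_eq_zero
      intro t ht
      rw [image_eq_zero_of_notMem_tsupport (fun h => ht (hsJ h)), zero_smul]
    rw [hres]
    apply hA.eq_zero_of_inner_right ℂ
    intro x hx
    rw [← integral_inner hint]
    have hw := hp φ hφ hs hsJ ⟨x, hx⟩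
    have hz : ∀ (c : ℝ → ℝ) (y : H),
        ∫ t in J, (c t : ℂ) * ⟪y, (0 : L2On H J) t⟫_ℂ = 0 := by
      intro c y
      have h := integral_mul_inner_smul c y 0 (0 : L2On H J)
      simpa using h
    simp only at hw
    rw [hz (deriv φ), hz φ, mul_zero, zero_add] at hw
    rw [hw]
    congr 1
    ext t
    rw [inner_smul_right_eq_smul]
    simp)
  rw [Lp.eq_zero_iff_ae_eq_zero, Filter.EventuallyEq, ae_restrict_iff' hJ.measurableSet]
  exact key

/-- On an open set, for densely defined `A`, the graph of `maxOp` is the set of all pairs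
`(u, g)` with `i u' + Ã u = g`. -/
theorem mem_maxOp_graph [CompleteSpace H] {A : H →ₗ.[ℂ] H}
    (hA : Dense (A.domain : Set H)) {J : Set ℝ} (hJ : IsOpen J) (u g : L2On H J) :
    (u, g) ∈ (maxOp A J).graph ↔ IsWeakSolution A J u g := by
  rw [maxOp, Submodule.toLinearPMap_graph_eq _ (maxGraph_singleValued hA hJ)]
  rfl

/-- The maximal operator `L = L₁ ⊕ L₂` in `L²(H, (-∞, a)) ⊕ L²(H, (b, ∞))`. -/
def maxOpSum (A : H →ₗ.[ℂ] H) (a b : ℝ) : L2Sum H a b →ₗ.[ℂ] L2Sum H a b where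
  domain :=
    { carrier := {u | u.fst ∈ (maxOp A (Iio a)).domain ∧ u.snd ∈ (maxOp A (Ioi b)).domain}
      zero_mem' := ⟨Submodule.zero_mem _, Submodule.zero_mem _⟩
      add_mem' := fun hu hv => ⟨Submodule.add_mem _ hu.1 hv.1, Submodule.add_mem _ hu.2 hv.2⟩
      smul_mem' := fun k _ hu => ⟨Submodule.smul_mem _ k hu.1, Submodule.smul_mem _ k hu.2⟩ }
  toFun :=
    { toFun := fun u => WithLp.toLp 2
        (maxOp A (Iio a) ⟨u.1.fst, u.2.1⟩, maxOp A (Ioi b) ⟨u.1.snd, u.2.2⟩)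
      map_add' := fun u v => by
        rw [← WithLp.toLp_add, Prod.mk_add_mk, ← LinearPMap.map_add, ← LinearPMap.map_add]
        rfl
      map_smul' := fun k u => by
        rw [RingHom.id_apply, ← WithLp.toLp_smul, Prod.smul_mk, ← LinearPMap.map_smul,
          ← LinearPMap.map_smul]
        rfl }

/-- The subspace of all `u = (u₁, u₂)` having representatives that are continuous up to the end
points `a` and `b` and satisfy the boundary condition `u₂(b) = W u₁(a)`. -/
def boundarySpace (a b : ℝ) (W : H ≃ₗᵢ[ℂ] H) : Submodule ℂ (L2Sum H a b) where
  carrier := {u | ∃ v₁ v₂ : ℝ → H, ContinuousOn v₁ (Iic a) ∧ ContinuousOn v₂ (Ici b) ∧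
    u.fst =ᵐ[volume.restrict (Iio a)] v₁ ∧ u.snd =ᵐ[volume.restrict (Ioi b)] v₂ ∧
    v₂ b = W (v₁ a)}
  zero_mem' := ⟨0, 0, continuousOn_const, continuousOn_const, Lp.coeFn_zero _ _ _,
    Lp.coeFn_zero _ _ _, by simp⟩
  add_mem' := by
    rintro u v ⟨u₁, u₂, hu₁, hu₂, hu₃, hu₄, hu₅⟩ ⟨v₁, v₂, hv₁, hv₂, hv₃, hv₄, hv₅⟩
    refine ⟨u₁ + v₁, u₂ + v₂, hu₁.add hv₁, hu₂.add hv₂, ?_, ?_, by simp [hu₅, hv₅]⟩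
    · exact (Lp.coeFn_add u.fst v.fst).trans (hu₃.add hv₃)
    · exact (Lp.coeFn_add u.snd v.snd).trans (hu₄.add hv₄)
  smul_mem' := by
    rintro k u ⟨u₁, u₂, hu₁, hu₂, hu₃, hu₄, hu₅⟩
    refine ⟨k • u₁, k • u₂, hu₁.const_smul k, hu₂.const_smul k, ?_, ?_, by simp [hu₅]⟩
    · exact (Lp.coeFn_smul k u.fst).trans (hu₃.const_smul k)
    · exact (Lp.coeFn_smul k u.snd).trans (hu₄.const_smul k)

/-- The extension `L_W`: the restriction of the maximal operator `L = L₁ ⊕ L₂` to the functions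
satisfying the boundary condition `u₂(b) = W u₁(a)`. -/
def extensionOp (A : H →ₗ.[ℂ] H) (a b : ℝ) (W : H ≃ₗᵢ[ℂ] H) :
    L2Sum H a b →ₗ.[ℂ] L2Sum H a b :=
  (maxOpSum A a b).domRestrict (boundarySpace a b W)

end MaximalOperator

section Resolvent

variable {E : Type*} [NormedAddCommGroup E] [NormedSpace ℂ E]

/-- The bounded operator `R` is the resolvent `(T - z)⁻¹` of the unbounded operator `T` at `z`. -/
def IsResolventAt (T : E →ₗ.[ℂ] E) (z : ℂ) (R : E →L[ℂ] E) : Prop :=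
  (∀ f : E, ∃ h : R f ∈ T.domain, T ⟨R f, h⟩ - z • R f = f) ∧
    ∀ u : T.domain, R (T u - z • (u : E)) = u

/-- The resolvent set `ρ(T)` of an unbounded operator `T`: all `z` such that `T - z` is a
bijection of the domain onto the whole space with bounded inverse. -/
def resolventSet (T : E →ₗ.[ℂ] E) : Set ℂ :=
  {z | ∃ R : E →L[ℂ] E, IsResolventAt T z R}

end Resolvent

section Exponential

variable {H : Type*} [NormedAddCommGroup H] [InnerProductSpace ℂ H]

/-- `U t = e^{itA}`: `U` is a strongly continuous one-parameter unitary group on `H` whose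
infinitesimal generator is exactly `iA`, domain included. -/
structure IsExpGroup [CompleteSpace H] (A : H →ₗ.[ℂ] H) (U : ℝ → H →L[ℂ] H) : Prop where
  unitary : ∀ t, U t ∈ unitary (H →L[ℂ] H)
  zero : U 0 = 1
  add : ∀ s t, U (s + t) = U s * U t
  continuous : ∀ x, Continuous fun t => U t x
  generator : ∀ x y, (x, y) ∈ A.graph ↔ HasDerivAt (fun t => U t x) (Complex.I • y) 0

/-- The operator `e^{-i(z - Ã)τ} = e^{-izτ} e^{iτÃ}`, restricted to `H`, for `U t = e^{itA}`. -/
def kernel (U : ℝ → H →L[ℂ] H) (z : ℂ) (τ : ℝ) : H →L[ℂ] H :=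
  Complex.exp (-(Complex.I * z * τ)) • U τ

/-- The boundary value `f_z^* = W^* (i ∫_b^∞ e^{-i(z - Ã)(b - s)} f₂(s) ds)`, for `Im z > 0`; the
adjoint of the unitary operator `W` is its inverse. -/
def upperDatum (U : ℝ → H →L[ℂ] H) (a b : ℝ) (W : H ≃ₗᵢ[ℂ] H) (z : ℂ) (f : L2Sum H a b) : H :=
  W.symm (Complex.I • ∫ s in Ioi b, kernel U z (b - s) (f.snd s))

/-- The boundary value `g_z^* = W (-i ∫_{-∞}^a e^{-i(z - Ã)(a - s)} f₁(s) ds)`, for `Im z < 0`. -/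
def lowerDatum (U : ℝ → H →L[ℂ] H) (a b : ℝ) (W : H ≃ₗᵢ[ℂ] H) (z : ℂ) (f : L2Sum H a b) : H :=
  W (-Complex.I • ∫ s in Iio a, kernel U z (a - s) (f.fst s))

end Exponential

end

end SingularDiff

/-! On a half line, `i u' + Ã u - z u = f` is a first order equation with constant operator
coefficient. Its solutions are the homogeneous ones, `kernel U z t c` with `c` a constant vector,
plus a Duhamel integral. Since `e^{itA}` is unitary, `‖kernel U z τ x‖ = e^{Im z · τ} ‖x‖`, so the
sign of `Im z` decides everything. If `Im z > 0`, homogeneous solutions decay towards `-∞`: every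
one is square integrable on `(-∞, a)`, and on `(b, ∞)` only zero is. Hence `u₂` is forced to be the
integral taken from infinity, its value at `b` and the condition `u₂(b) = W u₁(a)` fix `u₁(a)`, and
this fixes the homogeneous part of `u₁`. If `Im z < 0`, the half lines exchange roles.

Four ingredients carry the argument. Stone's theorem (`exists_isExpGroup`) supplies the group as a
limit of exponentials of bounded commuting approximations of `A`. The operator `volterra` solves the
equation on all of `ℝ` for a datum extended by zero: the proof is Fubini plus integration by parts
against `φ(t) x`, and Cauchy–Schwarz and Young's inequality with the exponential weight give the
constants `1/(2|Im z|)` and `1/|Im z|²`. Mollification (`IsWeakSolution.exists_ae_eq_kernel`) shows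
that a weak homogeneous solution is `kernel U z t c`, so decay and the boundary condition give
injectivity of `L_W - z`. Finally, injectivity and the explicit solution with its bound produce the
resolvent (`exists_isResolventAt`), and `IsResolventAt.apply_eq` transfers the formulas to any
operator satisfying the resolvent identities. -/

namespace SingularDiff

noncomputable section

/-! ### Stone's theorem by Yosida approximation -/

section Stone

open Filter Topology

variable {H : Type*} [NormedAddCommGroup H] [InnerProductSpace ℂ H] [CompleteSpace H]

/-- This is `A = A*` read on graphs. It is the only way in which membership in the domain of `A` is
established when constructing the group. -/
theorem mem_graph_iff_of_isSelfAdjoint {A : H →ₗ.[ℂ] H} (hA : IsSelfAdjoint A) (x y : H) :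
    (x, y) ∈ A.graph ↔ ∀ a b, (a, b) ∈ A.graph → ⟪b, x⟫_ℂ = ⟪a, y⟫_ℂ := by
  have h := LinearPMap.adjoint_graph_eq_graph_adjoint hA.dense_domain
  rw [LinearPMap.isSelfAdjoint_def.1 hA] at h
  conv_lhs => rw [h, Submodule.mem_adjoint_iff]
  simp only [sub_eq_zero]

/-- Symmetry makes `⟪y, x⟫` real, so the cross term in the expansion has real part zero. -/
theorem norm_sub_smul_sq {A : H →ₗ.[ℂ] H} (hA : IsSelfAdjoint A) (r : ℝ) {x y : H}
    (h : (x, y) ∈ A.graph) :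
    ‖y - ((r : ℂ) * Complex.I) • x‖ ^ 2 = ‖y‖ ^ 2 + r ^ 2 * ‖x‖ ^ 2 := by
  have hs := (mem_graph_iff_of_isSelfAdjoint hA x y).1 h x y h
  have him : (⟪x, y⟫_ℂ).im = 0 := by
    rw [← Complex.conj_eq_iff_im, inner_conj_symm, hs]
  have hre : (⟪y, x⟫_ℂ).im = 0 := by rw [hs, him]
  rw [@norm_sub_sq ℂ, inner_smul_right, norm_smul]
  simp [hre, mul_pow]

/-- The resolvent of a selfadjoint operator at a nonzero purely imaginary point. -/
theorem exists_resolvent_of_isSelfAdjoint {A : H →ₗ.[ℂ] H} (hA : IsSelfAdjoint A) {r : ℝ}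
    (hr : r ≠ 0) :
    ∃ R : H →L[ℂ] H, (∀ h, (R h, h + ((r : ℂ) * Complex.I) • R h) ∈ A.graph) ∧
      (∀ x y, (x, y) ∈ A.graph → R (y - ((r : ℂ) * Complex.I) • x) = x) ∧
      ∀ h, ‖R h‖ ≤ |r|⁻¹ * ‖h‖ := by
  have hr0 : 0 < |r| := abs_pos.2 hr
  have hlow : ∀ x y, (x, y) ∈ A.graph → ‖x‖ ≤ |r|⁻¹ * ‖y - ((r : ℂ) * Complex.I) • x‖ := by
    intro x y h
    rw [inv_mul_eq_div, le_div_iff₀ hr0]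
    apply le_of_sq_le_sq _ (norm_nonneg _)
    rw [norm_sub_smul_sq hA r h, mul_pow, sq_abs]
    nlinarith [sq_nonneg ‖y‖]
  have hlow2 : ∀ x y, (x, y) ∈ A.graph → ‖y‖ ≤ ‖y - ((r : ℂ) * Complex.I) • x‖ := by
    intro x y h
    apply le_of_sq_le_sq _ (norm_nonneg _)
    rw [norm_sub_smul_sq hA r h]
    nlinarith [mul_nonneg (sq_nonneg r) (sq_nonneg ‖x‖)]
  -- Working on the graph, complete because `A` is closed, makes `A - ri` a bounded operator; it is
  -- bounded below, so its range is closed.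
  let T : A.graph →L[ℂ] H :=
    (ContinuousLinearMap.snd ℂ H H - ((r : ℂ) * Complex.I) • ContinuousLinearMap.fst ℂ H H).comp
      A.graph.subtypeL
  have hT : ∀ p : A.graph, T p = p.1.2 - ((r : ℂ) * Complex.I) • p.1.1 := fun p => rfl
  have : CompleteSpace A.graph := by
    have h : IsClosed (A.graph : Set (H × H)) := hA.isClosed
    exact h.completeSpace_coe
  have hanti : AntilipschitzWith (max (Real.toNNReal |r|⁻¹) 1) T := by
    apply AddMonoidHomClass.antilipschitz_of_bound T
    intro p
    have h1 := hlow p.1.1 p.1.2 p.2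
    have h2 := hlow2 p.1.1 p.1.2 p.2
    rw [← hT p] at h1 h2
    have hc : ((max (Real.toNNReal |r|⁻¹) 1 : NNReal) : ℝ) = max |r|⁻¹ 1 := by
      rw [NNReal.coe_max, Real.coe_toNNReal _ (by positivity), NNReal.coe_one]
    rw [hc]
    change max ‖p.1.1‖ ‖p.1.2‖ ≤ _
    apply max_le
    · exact h1.trans (mul_le_mul_of_nonneg_right (le_max_left _ _) (norm_nonneg _))
    · refine h2.trans ?_
      conv_lhs => rw [← one_mul ‖T p‖]
      exact mul_le_mul_of_nonneg_right (le_max_right _ _) (norm_nonneg _)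
  have hclosed : IsClosed (Set.range T) := hanti.isClosed_range T.uniformContinuous
  have hcl : IsClosed ((LinearMap.range T.toLinearMap : Submodule ℂ H) : Set H) := by
    simpa using! hclosed
  -- A vector `h` orthogonal to the range lies in the domain of `A* = A` with `A h = -ri h`;
  -- symmetry then makes `ri ‖h‖²` vanish.
  have htop : LinearMap.range T.toLinearMap = ⊤ := by
    have : CompleteSpace (LinearMap.range T.toLinearMap) := hcl.completeSpace_coe
    rw [← Submodule.orthogonal_eq_bot_iff, Submodule.eq_bot_iff]
    intro h hh
    have hg : (h, -((r : ℂ) * Complex.I) • h) ∈ A.graph := by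
      rw [mem_graph_iff_of_isSelfAdjoint hA]
      intro x y hxy
      have := (Submodule.mem_orthogonal _ _).1 hh (T ⟨(x, y), hxy⟩) ⟨_, rfl⟩
      rw [hT, inner_sub_left, inner_smul_left, sub_eq_zero] at this
      rw [this, inner_smul_right]
      simp
    have h2 := norm_sub_smul_sq hA r hg
    have h1 := (mem_graph_iff_of_isSelfAdjoint hA _ _).1 hg _ _ hg
    rw [inner_smul_left, inner_smul_right] at h1
    have h3 : ((r : ℂ) * Complex.I) * ⟪h, h⟫_ℂ = 0 := by
      simp only [map_neg, map_mul, Complex.conj_ofReal, Complex.conj_I] at h1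
      linear_combination (1 / 2 : ℂ) * h1
    rcases mul_eq_zero.1 h3 with h4 | h4
    · simp [hr] at h4
    · exact inner_self_eq_zero.1 h4
  have hsurj : ∀ h, ∃ p : A.graph, T p = h := fun h => by
    have : h ∈ LinearMap.range T.toLinearMap := by rw [htop]; trivial
    exact this
  have hinj := hanti.injective
  let e : A.graph ≃ₗ[ℂ] H := LinearEquiv.ofBijective T.toLinearMap ⟨hinj, hsurj⟩
  have he : ∀ h, T (e.symm h) = h := fun h => e.apply_symm_apply h
  let R : H →ₗ[ℂ] H := (LinearMap.fst ℂ H H).comp (A.graph.subtype.comp e.symm.toLinearMap)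
  have hR : ∀ h, R h = (e.symm h).1.1 := fun h => rfl
  have hRb : ∀ h, ‖R h‖ ≤ |r|⁻¹ * ‖h‖ := by
    intro h
    have := hlow _ _ (e.symm h).2
    rw [← hT, he] at this
    exact this
  refine ⟨R.mkContinuous _ hRb, ?_, ?_, fun h => hRb h⟩
  · intro h
    have h1 : (e.symm h).1.2 = h + ((r : ℂ) * Complex.I) • (e.symm h).1.1 := by
      have := he h
      rw [hT] at this
      exact eq_add_of_sub_eq this
    rw [LinearMap.mkContinuous_apply, hR, ← h1]
    exact (e.symm h).2
  · intro x y hxy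
    rw [LinearMap.mkContinuous_apply, hR]
    have : e.symm (y - ((r : ℂ) * Complex.I) • x) = ⟨(x, y), hxy⟩ :=
      e.symm_apply_eq.2 rfl
    rw [this]

theorem exp_smul_I_unitary {D : H →L[ℂ] H} (hD : IsSelfAdjoint D) (t : ℝ) :
    NormedSpace.exp (t • Complex.I • D) ∈ unitary (H →L[ℂ] H) := by
  have hs : star (t • Complex.I • D) = -(t • Complex.I • D) := by
    simp [hD.star_eq]
  let _ : NormedAlgebra ℚ (H →L[ℂ] H) := NormedAlgebra.restrictScalars ℚ ℂ _
  rw [Unitary.mem_iff, NormedSpace.star_exp, hs,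
    ← NormedSpace.exp_add_of_commute (Commute.refl _).neg_left,
    ← NormedSpace.exp_add_of_commute (Commute.refl _).neg_right]
  simp

theorem norm_exp_smul_I_apply {D : H →L[ℂ] H} (hD : IsSelfAdjoint D) (t : ℝ) (x : H) :
    ‖NormedSpace.exp (t • Complex.I • D) x‖ = ‖x‖ :=
  ContinuousLinearMap.norm_map_of_mem_unitary (exp_smul_I_unitary hD t) x

theorem hasDerivAt_exp_smul_I_apply (D : H →L[ℂ] H) (x : H) (t : ℝ) :
    HasDerivAt (fun s : ℝ => NormedSpace.exp (s • Complex.I • D) x)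
      (NormedSpace.exp (t • Complex.I • D) (Complex.I • D x)) t := by
  have h := hasDerivAt_exp_smul_const (𝕂 := ℝ) (Complex.I • D) t
  have h2 := (((ContinuousLinearMap.apply ℂ H x).restrictScalars ℝ).hasFDerivAt
    (x := NormedSpace.exp (t • Complex.I • D))).comp_hasDerivAt t h
  exact h2

/-- Mean value inequality: the derivative is the image of `i D x` under an isometry. -/
theorem norm_exp_smul_I_sub_le {D : H →L[ℂ] H} (hD : IsSelfAdjoint D) (t : ℝ) (x : H) :
    ‖NormedSpace.exp (t • Complex.I • D) x - x‖ ≤ |t| * ‖D x‖ := by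
  have h := (convex_univ (𝕜 := ℝ) (E := ℝ)).norm_image_sub_le_of_norm_hasDerivWithin_le
    (f := fun s : ℝ => NormedSpace.exp (s • Complex.I • D) x) (C := ‖D x‖) (x := 0) (y := t)
    (fun s _ => (hasDerivAt_exp_smul_I_apply D x s).hasDerivWithinAt)
    (fun s _ => by rw [norm_exp_smul_I_apply hD, norm_smul]; simp) trivial trivial
  simpa [mul_comm] using h

/-- A direct second order estimate would involve `D (D x)`, which is not controlled along the Yosida
approximations when `x` is merely in the domain of `A`. The auxiliary `y`, later a domain vector
close to `A x`, replaces `D x` at the price of `2 ‖D x - y‖`. -/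
theorem norm_exp_smul_I_sub_sub_le {D : H →L[ℂ] H} (hD : IsSelfAdjoint D) (t : ℝ) (x y : H) :
    ‖NormedSpace.exp (t • Complex.I • D) x - x - t • Complex.I • D x‖
      ≤ |t| * (2 * ‖D x - y‖ + |t| * ‖D y‖) := by
  have hd : ∀ s : ℝ, HasDerivAt
      (fun s : ℝ => NormedSpace.exp (s • Complex.I • D) x - s • Complex.I • D x)
      (NormedSpace.exp (s • Complex.I • D) (Complex.I • D x) - (1 : ℝ) • Complex.I • D x) s :=
    fun s => (hasDerivAt_exp_smul_I_apply D x s).sub ((hasDerivAt_id s).smul_const _)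
  have hb : ∀ s ∈ uIcc 0 t, ‖NormedSpace.exp (s • Complex.I • D) (Complex.I • D x)
      - (1 : ℝ) • Complex.I • D x‖ ≤ 2 * ‖D x - y‖ + |t| * ‖D y‖ := by
    intro s hs
    have hst : |s| ≤ |t| := by simpa using abs_sub_left_of_mem_uIcc hs
    have e1 : NormedSpace.exp (s • Complex.I • D) (Complex.I • D x) - (1 : ℝ) • Complex.I • D x
        = Complex.I • (NormedSpace.exp (s • Complex.I • D) (D x - y) - (D x - y)
          + (NormedSpace.exp (s • Complex.I • D) y - y)) := by
      rw [one_smul, map_smul, map_sub, ← smul_sub]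
      congr 1
      abel
    rw [e1, norm_smul, Complex.norm_I, one_mul]
    refine (norm_add_le _ _).trans (add_le_add ((norm_sub_le _ _).trans ?_)
      ((norm_exp_smul_I_sub_le hD s y).trans ?_))
    · rw [norm_exp_smul_I_apply hD]; linarith
    · exact mul_le_mul_of_nonneg_right hst (norm_nonneg _)
  have h := (convex_uIcc 0 t).norm_image_sub_le_of_norm_hasDerivWithin_le
    (fun s _ => (hd s).hasDerivWithinAt) hb left_mem_uIcc right_mem_uIcc
  have e2 : NormedSpace.exp (t • Complex.I • D) x - x - t • Complex.I • D x
      = NormedSpace.exp (t • Complex.I • D) x - t • Complex.I • D x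
        - (NormedSpace.exp ((0 : ℝ) • Complex.I • D) x - (0 : ℝ) • Complex.I • D x) := by
    simp; abel
  rw [e2, mul_comm]
  simpa using h

/-- Commutation allows `e^{itD} = e^{itE} e^{it(D - E)}`, which reduces the difference to
`norm_exp_smul_I_sub_le`. This makes the approximating groups Cauchy. -/
theorem norm_exp_smul_I_sub_exp_le {D E : H →L[ℂ] H} (hD : IsSelfAdjoint D)
    (hE : IsSelfAdjoint E) (hDE : Commute D E) (t : ℝ) (x : H) :
    ‖NormedSpace.exp (t • Complex.I • D) x - NormedSpace.exp (t • Complex.I • E) x‖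
      ≤ |t| * ‖D x - E x‖ := by
  let _ : NormedAlgebra ℚ (H →L[ℂ] H) := NormedAlgebra.restrictScalars ℚ ℂ _
  have hc : Commute (t • Complex.I • E) (t • Complex.I • (D - E)) :=
    ((((hDE.symm.sub_right (Commute.refl E)).smul_left _).smul_right _).smul_left _).smul_right _
  have e1 : t • Complex.I • D = t • Complex.I • E + t • Complex.I • (D - E) := by
    rw [← smul_add, ← smul_add, add_sub_cancel]
  rw [e1, NormedSpace.exp_add_of_commute hc, mul_apply_eq_comp, ← map_sub,
    norm_exp_smul_I_apply hE]
  exact norm_exp_smul_I_sub_le (hD.sub hE) t x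

/-- A selfadjoint operator is the strong limit, on its domain, of commuting bounded selfadjoint
operators (its Yosida approximations). -/
theorem exists_yosida_approximation {A : H →ₗ.[ℂ] H} (hA : IsSelfAdjoint A) :
    ∃ D : ℕ → H →L[ℂ] H, (∀ n, IsSelfAdjoint (D n)) ∧ (∀ n m, Commute (D n) (D m)) ∧
      ∀ x y, (x, y) ∈ A.graph → Tendsto (fun n => D n x) atTop (𝓝 y) := by
  have hex : ∀ r : ℝ, ∃ R : H →L[ℂ] H, r ≠ 0 →
      (∀ h, (R h, h + ((r : ℂ) * Complex.I) • R h) ∈ A.graph) ∧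
      (∀ x y, (x, y) ∈ A.graph → R (y - ((r : ℂ) * Complex.I) • x) = x) ∧
      ∀ h, ‖R h‖ ≤ |r|⁻¹ * ‖h‖ := by
    intro r
    by_cases hr : r = 0
    · exact ⟨0, fun h => absurd hr h⟩
    · obtain ⟨R, hR⟩ := exists_resolvent_of_isSelfAdjoint hA hr
      exact ⟨R, fun _ => hR⟩
  choose R hR using hex
  -- Both orders of the product come from the resolvent identity, divided by `(s - r) i`.
  have hcomm : ∀ r s, r ≠ 0 → s ≠ 0 → Commute (R r) (R s) := by
    intro r s hr hs
    by_cases hrs : r = s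
    · rw [hrs]
    have key : ∀ r s, r ≠ 0 → s ≠ 0 → ∀ h,
        R s h - R r h = (((s - r : ℝ) : ℂ) * Complex.I) • R r (R s h) := by
      intro r s hr hs h
      have h1 := (hR r hr).2.1 _ _ ((hR s hs).1 h)
      rw [map_sub, map_add, map_smul, map_smul] at h1
      rw [sub_eq_iff_eq_add]
      conv_lhs => rw [← h1]
      push_cast
      module
    have hne : (((s - r : ℝ) : ℂ) * Complex.I) ≠ 0 := by
      simpa [sub_eq_zero] using fun h : (s : ℂ) = r => hrs (by exact_mod_cast h.symm)
    ext h
    rw [mul_apply_eq_comp, mul_apply_eq_comp]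
    apply smul_right_injective H hne
    simp only
    rw [← key r s hr hs, ← neg_sub, key s r hs hr, ← neg_smul]
    push_cast
    module
  have hadj : ∀ r, r ≠ 0 → ∀ h k, ⟪R r h, k⟫_ℂ = ⟪h, R (-r) k⟫_ℂ := by
    intro r hr h k
    have h1 := (mem_graph_iff_of_isSelfAdjoint hA _ _).1 ((hR (-r) (neg_ne_zero.2 hr)).1 k) _ _
      ((hR r hr).1 h)
    rw [inner_add_left, inner_add_right, inner_smul_left, inner_smul_right] at h1
    simp only [map_mul, Complex.conj_ofReal, Complex.conj_I, Complex.ofReal_neg] at h1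
    linear_combination -h1
  have hr0 : ∀ n : ℕ, (n + 1 : ℝ) ≠ 0 := fun n => by positivity
  have hr1 : ∀ n : ℕ, -(n + 1 : ℝ) ≠ 0 := fun n => neg_ne_zero.2 (hr0 n)
  have hsmall : ∀ y, Tendsto (fun n : ℕ => R (n + 1) y) atTop (𝓝 0) ∧
      Tendsto (fun n : ℕ => R (-(n + 1)) y) atTop (𝓝 0) := by
    intro y
    have hz : Tendsto (fun n : ℕ => |(n + 1 : ℝ)|⁻¹ * ‖y‖) atTop (𝓝 0) := by
      have : Tendsto (fun n : ℕ => (1 / ((n : ℝ) + 1)) * ‖y‖) atTop (𝓝 (0 * ‖y‖)) :=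
        tendsto_one_div_add_atTop_nhds_zero_nat.mul_const _
      rw [zero_mul] at this
      refine this.congr fun n => ?_
      rw [abs_of_pos (by positivity), one_div]
    refine ⟨squeeze_zero_norm (fun n => (hR _ (hr0 n)).2.2 y) hz,
      squeeze_zero_norm (fun n => ?_) hz⟩
    have := (hR _ (hr1 n)).2.2 y
    rwa [abs_neg] at this
  -- With `m = n + 1` and `R r = (A - ri)⁻¹`, this is `m² (A² + m²)⁻¹`, a contraction tending
  -- strongly to the identity. Below, `D n` is `m² A (A² + m²)⁻¹`, so that `D n x = J n (A x)` on
  -- the domain.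
  let J : ℕ → H →L[ℂ] H := fun n =>
    (-((n + 1 : ℝ) : ℂ) * Complex.I / 2) • (R (n + 1) - R (-(n + 1)))
  have hJ : ∀ n y, J n y
      = (-((n + 1 : ℝ) : ℂ) * Complex.I / 2) • (R (n + 1) y - R (-(n + 1)) y) := fun n y => rfl
  have hJb : ∀ n y, ‖J n y‖ ≤ ‖y‖ := by
    intro n y
    have hp : (0 : ℝ) < n + 1 := by positivity
    have h1 := (hR _ (hr0 n)).2.2 y
    have h2 := (hR _ (hr1 n)).2.2 y
    rw [abs_neg] at h2
    rw [abs_of_pos hp] at h1 h2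
    rw [hJ, norm_smul]
    have e : ‖(-((n + 1 : ℝ) : ℂ) * Complex.I / 2)‖ = (n + 1) / 2 := by
      rw [norm_div, norm_mul, norm_neg, Complex.norm_I, Complex.norm_real, Real.norm_eq_abs,
        abs_of_pos hp]
      simp
    rw [e]
    calc (n + 1 : ℝ) / 2 * ‖R (n + 1) y - R (-(n + 1)) y‖
        ≤ (n + 1 : ℝ) / 2 * ((n + 1 : ℝ)⁻¹ * ‖y‖ + (n + 1 : ℝ)⁻¹ * ‖y‖) := by
          gcongr
          exact (norm_sub_le _ _).trans (add_le_add h1 h2)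
      _ = ‖y‖ := by field_simp; ring
  -- These rewrite `R (A - ri) x = x` so that a factor `n + 1` times the resolvent becomes a bounded
  -- expression in `x` and `A x`.
  have hexp : ∀ (n : ℕ) x y, (x, y) ∈ A.graph →
      ((n + 1 : ℝ) : ℂ) • R (n + 1) x = -Complex.I • (R (n + 1) y - x) ∧
      ((n + 1 : ℝ) : ℂ) • R (-(n + 1)) x = Complex.I • (R (-(n + 1)) y - x) := by
    intro n x y hxy
    have h1 := (hR _ (hr0 n)).2.1 _ _ hxy
    have h2 := (hR _ (hr1 n)).2.1 _ _ hxy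
    rw [map_sub, map_smul] at h1 h2
    rw [Complex.ofReal_neg] at h2
    constructor
    · conv_rhs => rw [← h1]
      rw [sub_sub_cancel, smul_smul]
      congr 1
      ring_nf
      simp
    · conv_rhs => rw [← h2]
      rw [sub_sub_cancel, smul_smul]
      congr 1
      ring_nf
      simp
  have hJlim : ∀ y, Tendsto (fun n => J n y) atTop (𝓝 y) := by
    have hdom : ∀ y w, (y, w) ∈ A.graph → Tendsto (fun n => J n y) atTop (𝓝 y) := by
      intro y w hyw
      have he : ∀ n, J n y = y - (1 / 2 : ℂ) • (R (n + 1) w + R (-(n + 1)) w) := by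
        intro n
        obtain ⟨h1, h2⟩ := hexp n y w hyw
        have e : J n y = (-Complex.I / 2) • (((n + 1 : ℝ) : ℂ) • R (n + 1) y
            - ((n + 1 : ℝ) : ℂ) • R (-(n + 1)) y) := by
          rw [hJ]; module
        rw [e, h1, h2, ← sub_eq_zero]
        have hI : Complex.I * Complex.I = -1 := Complex.I_mul_I
        match_scalars
        · linear_combination (1 / 2 : ℂ) * hI
        · linear_combination (-1 : ℂ) * hI
        · linear_combination (1 / 2 : ℂ) * hI
      have h3 := tendsto_const_nhds (x := y) (f := (atTop : Filter ℕ)) |>.sub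
        (((hsmall w).1.add (hsmall w).2).const_smul (1 / 2 : ℂ))
      rw [add_zero, smul_zero, sub_zero] at h3
      exact h3.congr fun n => (he n).symm
    -- Convergence passes from the dense domain to all vectors by the uniform bound `hJb`.
    intro y
    rw [Metric.tendsto_atTop]
    intro ε hε
    obtain ⟨y', hy', hyy⟩ := Metric.dense_iff.1 hA.dense_domain y (ε / 3) (by positivity)
    rw [Metric.mem_ball, dist_eq_norm] at hy'
    obtain ⟨N, hN⟩ := Metric.tendsto_atTop.1 (hdom y' _ (LinearPMap.mem_graph A ⟨y', hyy⟩))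
      (ε / 3) (by positivity)
    refine ⟨N, fun n hn => ?_⟩
    have h1 := hN n hn
    rw [dist_eq_norm] at h1 ⊢
    have e : J n y - y = -J n (y' - y) + (J n y' - y') + (y' - y) := by
      rw [map_sub]; abel
    rw [e]
    calc _ ≤ ‖-J n (y' - y)‖ + ‖J n y' - y'‖ + ‖y' - y‖ := norm_add₃_le
      _ < ε / 3 + ε / 3 + ε / 3 := by
        rw [norm_neg]
        have := hJb n (y' - y)
        linarith
      _ = ε := by ring
  let D : ℕ → H →L[ℂ] H := fun n =>
    (((n + 1 : ℝ) ^ 2 / 2 : ℝ) : ℂ) • (R (n + 1) + R (-(n + 1)))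
  refine ⟨D, ?_, ?_, ?_⟩
  · intro n
    rw [ContinuousLinearMap.isSelfAdjoint_iff_isSymmetric]
    intro h k
    have h1 := hadj _ (hr0 n) h k
    have h2 := hadj _ (hr1 n) h k
    rw [neg_neg] at h2
    simp only [D, ContinuousLinearMap.coe_coe, smul_apply,
      add_apply, inner_smul_left, inner_smul_right, inner_add_left,
      inner_add_right, h1, h2, Complex.conj_ofReal]
    ring
  · intro n m
    have h1 := hcomm _ _ (hr0 n) (hr0 m)
    have h2 := hcomm _ _ (hr0 n) (hr1 m)
    have h3 := hcomm _ _ (hr1 n) (hr0 m)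
    have h4 := hcomm _ _ (hr1 n) (hr1 m)
    exact (((h1.add_right h2).add_left (h3.add_right h4)).smul_left _).smul_right _
  · intro x y hxy
    refine (hJlim y).congr fun n => ?_
    obtain ⟨h1, h2⟩ := hexp n x y hxy
    have e : D n x = (((n + 1 : ℝ) : ℂ) / 2) • (((n + 1 : ℝ) : ℂ) • R (n + 1) x
        + ((n + 1 : ℝ) : ℂ) • R (-(n + 1)) x) := by
      simp only [D, smul_apply, add_apply]
      push_cast
      module
    rw [e, h1, h2, hJ]
    module

/-! ### Properties and uniqueness of the unitary group -/

namespace IsExpGroup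

variable {A : H →ₗ.[ℂ] H} {U : ℝ → H →L[ℂ] H}

theorem norm_apply (hU : IsExpGroup A U) (t : ℝ) (x : H) : ‖U t x‖ = ‖x‖ :=
  ContinuousLinearMap.norm_map_of_mem_unitary (hU.unitary t) x

theorem apply_neg_apply (hU : IsExpGroup A U) (t : ℝ) (x : H) : U t (U (-t) x) = x := by
  rw [← mul_apply_eq_comp, ← hU.add, add_neg_cancel, hU.zero]; rfl

theorem add_apply (hU : IsExpGroup A U) (s t : ℝ) (x : H) : U (s + t) x = U s (U t x) := by
  rw [hU.add]; rfl

theorem inner_apply (hU : IsExpGroup A U) (t : ℝ) (x y : H) :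
    ⟪U t x, y⟫_ℂ = ⟪x, U (-t) y⟫_ℂ := by
  rw [← ContinuousLinearMap.inner_map_map_of_mem_unitary (hU.unitary t) x, hU.apply_neg_apply]

theorem hasDerivAt (hU : IsExpGroup A U) {x y : H} (h : (x, y) ∈ A.graph) (t : ℝ) :
    HasDerivAt (fun s => U s x) (U t (Complex.I • y)) t := by
  have h0 : HasDerivAt (fun s => U s x) (Complex.I • y) (t - t) := by
    rw [sub_self]; exact (hU.generator x y).1 h
  have h1 : HasDerivAt (fun s => U (s - t) x) (Complex.I • y) t := by
    simpa using h0.comp_sub_const t t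
  have h2 := (((U t).restrictScalars ℝ).hasFDerivAt (x := U (t - t) x)).comp_hasDerivAt t h1
  refine h2.congr_of_eventuallyEq (Eventually.of_forall fun s => ?_)
  change U s x = U t (U (s - t) x)
  rw [← hU.add_apply, add_sub_cancel]

theorem apply_mem_graph (hU : IsExpGroup A U) {x y : H} (h : (x, y) ∈ A.graph) (t : ℝ) :
    (U t x, U t y) ∈ A.graph := by
  rw [hU.generator]
  have h1 := (hU.generator x y).1 h
  have h2 := (((U t).restrictScalars ℝ).hasFDerivAt (x := U 0 x)).comp_hasDerivAt 0 h1
  have h3 : ((U t).restrictScalars ℝ) (Complex.I • y) = Complex.I • U t y := map_smul (U t) _ _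
  rw [h3] at h2
  refine h2.congr_of_eventuallyEq (Eventually.of_forall fun s => ?_)
  change U s (U t x) = U t (U s x)
  rw [← hU.add_apply, ← hU.add_apply, add_comm]

/-- Strong continuity and isometry together give joint continuity, from which measurability of `s ↦
kernel U z (t - s) (F s)` follows later. -/
theorem continuous_uncurry (hU : IsExpGroup A U) :
    Continuous fun p : ℝ × H => U p.1 p.2 := by
  rw [continuous_iff_continuousAt]
  rintro ⟨t, x⟩
  rw [ContinuousAt, tendsto_iff_norm_sub_tendsto_zero]
  have h1 : Tendsto (fun p : ℝ × H => ‖p.2 - x‖ + ‖U p.1 x - U t x‖) (𝓝 (t, x)) (𝓝 0) := by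
    have : Continuous fun p : ℝ × H => ‖p.2 - x‖ + ‖U p.1 x - U t x‖ :=
      (continuous_snd.sub continuous_const).norm.add
        (((hU.continuous x).comp continuous_fst).sub continuous_const).norm
    simpa using this.tendsto (t, x)
  refine squeeze_zero (fun _ => norm_nonneg _) (fun p => ?_) h1
  calc ‖U p.1 p.2 - U t x‖ = ‖U p.1 (p.2 - x) + (U p.1 x - U t x)‖ := by
        rw [map_sub]; congr 1; abel
    _ ≤ _ := (norm_add_le _ _).trans (by rw [hU.norm_apply])

/-- For domain vectors, `⟪U s x, V s v⟫` has derivative zero because the common generator is `i`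
times a symmetric operator. It therefore equals `⟪x, v⟫ = ⟪V t x, V t v⟫` at time `t`, and density
of the domain gives `V t x = U t x`. -/
theorem apply_ext {V : ℝ → H →L[ℂ] H} (hU : IsExpGroup A U) (hV : IsExpGroup A V)
    (hA : Dense (A.domain : Set H)) : V = U := by
  ext t x
  refine congrFun (Continuous.ext_on hA (V t).continuous (U t).continuous fun x hx => ?_) x
  have hx' : (x, A ⟨x, hx⟩) ∈ A.graph := LinearPMap.mem_graph A ⟨x, hx⟩
  set y := A ⟨x, hx⟩
  have key : ∀ v w, (v, w) ∈ A.graph → ⟪V t x, V t v⟫_ℂ = ⟪U t x, V t v⟫_ℂ := by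
    intro v w hv
    have hd : ∀ s, HasDerivAt (fun s => ⟪U s x, V s v⟫_ℂ)
        (⟪U s x, V s (Complex.I • w)⟫_ℂ + ⟪U s (Complex.I • y), V s v⟫_ℂ) s :=
      fun s => (hU.hasDerivAt hx' s).inner ℂ (hV.hasDerivAt hv s)
    have hz : ∀ s, ⟪U s x, V s (Complex.I • w)⟫_ℂ + ⟪U s (Complex.I • y), V s v⟫_ℂ = 0 := by
      intro s
      have h1 := (hU.generator (U s x) (U s y)).1 (hU.apply_mem_graph hx' s)
      have h2 := (hU.generator (V s v) (V s w)).1 (hV.apply_mem_graph hv s)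
      have h3 : HasDerivAt (fun r => U (-r) (V s v)) (-(Complex.I • V s w)) 0 := by
        have := HasDerivAt.scomp (0 : ℝ) (h := fun r : ℝ => -r) (by simpa using h2)
          (hasDerivAt_neg (0 : ℝ))
        simpa using! this
      have h4 := h1.inner ℂ (hasDerivAt_const (0 : ℝ) (V s v))
      have h5 := (hasDerivAt_const (0 : ℝ) (U s x)).inner ℂ h3
      -- Differentiating `⟪U r p, q⟫ = ⟪p, U (-r) q⟫` at `r = 0` in two ways yields the symmetry of
      -- `A` at `p = U s x`, `q = V s v`.
      have h6 := h4.unique (h5.congr_of_eventuallyEq (Eventually.of_forall fun r =>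
        hU.inner_apply r _ _))
      simp only [inner_zero_right, inner_zero_left, zero_add, add_zero, hU.zero,
        neg_zero, one_apply_eq_self, inner_neg_right] at h6
      rw [map_smul, map_smul, h6, add_neg_cancel]
    have hc := is_const_of_deriv_eq_zero (fun s => (hd s).differentiableAt)
      (fun s => by rw [(hd s).deriv, hz s]) t 0
    have h0 : ⟪V t x, V t v⟫_ℂ = ⟪x, v⟫_ℂ :=
      ContinuousLinearMap.inner_map_map_of_mem_unitary (hV.unitary t) x v
    simp only [hU.zero, hV.zero, one_apply_eq_self] at hc
    rw [h0, hc]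
  have h2 : V (-t) (V t x) = V (-t) (U t x) := by
    apply hA.eq_of_inner_left ℂ
    intro v hv
    have := key v _ (LinearPMap.mem_graph A ⟨v, hv⟩)
    rw [hV.inner_apply (-t), hV.inner_apply (-t), neg_neg]
    exact this
  calc V t x = V t (V (-t) (V t x)) := by rw [hV.apply_neg_apply]
    _ = U t x := by rw [h2, hV.apply_neg_apply]

end IsExpGroup

/-- **Stone's theorem**: a selfadjoint operator generates a strongly continuous unitary group. -/
theorem exists_isExpGroup {A : H →ₗ.[ℂ] H} (hA : IsSelfAdjoint A) :
    ∃ U : ℝ → H →L[ℂ] H, IsExpGroup A U := by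
  obtain ⟨D, hD, hDc, hDA⟩ := exists_yosida_approximation hA
  let E : ℕ → ℝ → H →L[ℂ] H := fun n t => NormedSpace.exp (t • Complex.I • D n)
  have hE : ∀ n t x, ‖E n t x‖ = ‖x‖ := fun n t x => norm_exp_smul_I_apply (hD n) t x
  have hcauchy : ∀ t x, CauchySeq fun n => E n t x := by
    intro t x
    rw [Metric.cauchySeq_iff]
    intro ε hε
    obtain ⟨y, hy, hyd⟩ := Metric.dense_iff.1 hA.dense_domain x (ε / 3) (by positivity)
    rw [Metric.mem_ball, dist_eq_norm] at hy
    have hcy := (hDA y _ (LinearPMap.mem_graph A ⟨y, hyd⟩)).cauchySeq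
    obtain ⟨N, hN⟩ := Metric.cauchySeq_iff.1 hcy (ε / (3 * (|t| + 1))) (by positivity)
    refine ⟨N, fun m hm n hn => ?_⟩
    have h1 := hN m hm n hn
    rw [dist_eq_norm] at h1 ⊢
    have h2 : ‖E m t y - E n t y‖ ≤ |t| * ‖D m y - D n y‖ :=
      norm_exp_smul_I_sub_exp_le (hD m) (hD n) (hDc m n) t y
    have h3 : |t| * ‖D m y - D n y‖ ≤ ε / 3 := by
      calc |t| * ‖D m y - D n y‖ ≤ (|t| + 1) * (ε / (3 * (|t| + 1))) := by
            gcongr; linarith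
        _ = ε / 3 := by field_simp
    have e : E m t x - E n t x = -E m t (y - x) + (E m t y - E n t y) + E n t (y - x) := by
      rw [map_sub, map_sub]; abel
    rw [e]
    refine norm_add₃_le.trans_lt ?_
    rw [norm_neg, hE, hE]
    linarith
  choose u hu using fun t x => cauchySeq_tendsto_of_complete (hcauchy t x)
  have hlim : ∀ t, Tendsto (fun n x => E n t x) atTop (𝓝 (u t)) := fun t =>
    tendsto_pi_nhds.2 (hu t)
  let U : ℝ → H →L[ℂ] H := fun t => continuousLinearMapOfTendsto (E · t) (hlim t)
  have hU : ∀ t x, Tendsto (fun n => E n t x) atTop (𝓝 (U t x)) := fun t x => hu t x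
  have hn : ∀ t x, ‖U t x‖ = ‖x‖ := fun t x =>
    tendsto_nhds_unique (hU t x).norm (by simp only [hE]; exact tendsto_const_nhds)
  have h0 : U 0 = 1 := by
    ext x
    refine tendsto_nhds_unique (hU 0 x) ?_
    simp only [E, zero_smul, NormedSpace.exp_zero]
    exact tendsto_const_nhds
  have hadd : ∀ s t, U (s + t) = U s * U t := by
    intro s t
    ext x
    refine tendsto_nhds_unique (hU (s + t) x) ?_
    -- The argument of `E n s` moves with `n`; splitting off its limit leaves an error whose norm is
    -- preserved by `E n s`.
    have e : ∀ n, E n (s + t) x = E n s (E n t x - U t x) + E n s (U t x) := by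
      intro n
      let _ : NormedAlgebra ℚ (H →L[ℂ] H) := NormedAlgebra.restrictScalars ℚ ℂ _
      rw [map_sub, sub_add_cancel]
      simp only [E]
      rw [add_smul, NormedSpace.exp_add_of_commute
        (((Commute.refl (Complex.I • D n)).smul_left _).smul_right _)]
      rfl
    simp only [e]
    have h1 : Tendsto (fun n => E n s (E n t x - U t x)) atTop (𝓝 0) := by
      rw [tendsto_zero_iff_norm_tendsto_zero]
      simp only [hE]
      exact tendsto_iff_norm_sub_tendsto_zero.1 (hU t x)
    simpa using! h1.add (hU s (U t x))
  have hinner : ∀ t x y, ⟪U t x, y⟫_ℂ = ⟪x, U (-t) y⟫_ℂ := by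
    intro t x y
    have e1 : U t (U (-t) y) = y := by
      rw [← mul_apply_eq_comp, ← hadd, add_neg_cancel, h0]; rfl
    conv_lhs => rw [← e1]
    exact (⟨(U t).toLinearMap, hn t⟩ : H →ₗᵢ[ℂ] H).inner_map_map x (U (-t) y)
  have huni : ∀ t, U t ∈ unitary (H →L[ℂ] H) := by
    intro t
    have hstar : star (U t) = U (-t) := by
      symm
      rw [ContinuousLinearMap.star_eq_adjoint, ContinuousLinearMap.eq_adjoint_iff]
      intro x y
      simpa using hinner (-t) x y
    rw [Unitary.mem_iff, hstar, ← hadd, ← hadd]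
    simp [h0]
  have hsmall : ∀ x w, (x, w) ∈ A.graph → ∀ t, ‖U t x - x‖ ≤ |t| * ‖w‖ := by
    intro x w hxw t
    refine le_of_tendsto_of_tendsto' ((hU t x).sub_const x).norm
      ((hDA x w hxw).norm.const_mul |t|) fun n => norm_exp_smul_I_sub_le (hD n) t x
  have hderiv : ∀ x y, (x, y) ∈ A.graph → ∀ y' w, (y', w) ∈ A.graph → ∀ t : ℝ,
      ‖U t x - x - t • Complex.I • y‖ ≤ |t| * (2 * ‖y - y'‖ + |t| * ‖w‖) := by
    intro x y hxy y' w hyw t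
    have h1 := hDA x y hxy
    have h2 := hDA y' w hyw
    exact le_of_tendsto_of_tendsto'
      (((hU t x).sub_const x).sub ((h1.const_smul Complex.I).const_smul t)).norm
      ((((h1.sub_const y').norm.const_mul 2).add (h2.norm.const_mul |t|)).const_mul |t|)
      fun n => norm_exp_smul_I_sub_sub_le (hD n) t x y'
  have hcont0 : ∀ x, ContinuousAt (fun t => U t x) 0 := by
    intro x
    rw [Metric.continuousAt_iff]
    intro ε hε
    obtain ⟨y, hy, hyd⟩ := Metric.dense_iff.1 hA.dense_domain x (ε / 3) (by positivity)
    rw [Metric.mem_ball, dist_eq_norm] at hy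
    have h1 := hsmall y _ (LinearPMap.mem_graph A ⟨y, hyd⟩)
    set w := A ⟨y, hyd⟩
    refine ⟨ε / (3 * (‖w‖ + 1)), by positivity, fun t ht => ?_⟩
    rw [dist_eq_norm, sub_zero, Real.norm_eq_abs] at ht
    rw [dist_eq_norm, h0, one_apply_eq_self]
    have h3 : |t| * ‖w‖ ≤ ε / 3 := by
      calc |t| * ‖w‖ ≤ (ε / (3 * (‖w‖ + 1))) * (‖w‖ + 1) := by gcongr; linarith
        _ = ε / 3 := by field_simp
    have e : U t x - x = -U t (y - x) + (U t y - y) + (y - x) := by rw [map_sub]; abel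
    rw [e]
    refine norm_add₃_le.trans_lt ?_
    rw [norm_neg, hn]
    have := h1 t
    linarith
  have hgen : ∀ x y, (x, y) ∈ A.graph → HasDerivAt (fun t => U t x) (Complex.I • y) 0 := by
    intro x y hxy
    rw [hasDerivAt_iff_isLittleO, Asymptotics.isLittleO_iff]
    intro ε hε
    -- The error `2 ‖y - y'‖` uses up `ε / 2`; the other half pays for `|t| ‖A y'‖` once `t` is
    -- small.
    obtain ⟨y', hy, hyd⟩ := Metric.dense_iff.1 hA.dense_domain y (ε / 4) (by positivity)
    rw [Metric.mem_ball, dist_eq_norm, norm_sub_rev] at hy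
    have h1 := hderiv x y hxy y' _ (LinearPMap.mem_graph A ⟨y', hyd⟩)
    set w := A ⟨y', hyd⟩
    have hev : ∀ᶠ t : ℝ in 𝓝 0, |t| < ε / (2 * (‖w‖ + 1)) := by
      have : Tendsto (fun t : ℝ => |t|) (𝓝 0) (𝓝 0) := by
        simpa using continuous_abs.tendsto (0 : ℝ)
      exact this.eventually_lt_const (by positivity)
    filter_upwards [hev] with t ht
    rw [sub_zero, h0, one_apply_eq_self, Real.norm_eq_abs, mul_comm]
    refine (h1 t).trans (mul_le_mul_of_nonneg_left ?_ (abs_nonneg t))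
    have h3 : |t| * ‖w‖ ≤ ε / 2 := by
      calc |t| * ‖w‖ ≤ (ε / (2 * (‖w‖ + 1))) * (‖w‖ + 1) := by gcongr; linarith
        _ = ε / 2 := by field_simp
    linarith
  refine ⟨U, huni, h0, hadd, fun x => ?_, fun x y => ⟨hgen x y, fun hd => ?_⟩⟩
  · rw [continuous_iff_continuousAt]
    intro t
    have h1 : ContinuousAt (fun s => U s x) (t - t) := by rw [sub_self]; exact hcont0 x
    have h2 : ContinuousAt (fun s => U t (U (s - t) x)) t :=
      (U t).continuous.continuousAt.comp
        (ContinuousAt.comp (f := fun s => s - t) (g := fun s => U s x) h1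
          (continuous_id.sub continuous_const).continuousAt)
    refine h2.congr (Eventually.of_forall fun s => ?_)
    change U t (U (s - t) x) = U s x
    rw [← mul_apply_eq_comp, ← hadd, add_sub_cancel]
  -- Exactness of the domain: if `U t x` is differentiable at `0` with derivative `i y`,
  -- differentiating `⟪U r v, x⟫ = ⟪v, U (-r) x⟫` gives `⟪A v, x⟫ = ⟪v, y⟫` for all domain vectors
  -- `v`, so `(x, y)` is in the graph of `A* = A`.
  · rw [mem_graph_iff_of_isSelfAdjoint hA]
    intro v w hvw
    have h1 := (hgen v w hvw).inner ℂ (hasDerivAt_const (0 : ℝ) x)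
    have h2 : HasDerivAt (fun t => U (-t) x) (-(Complex.I • y)) 0 := by
      have := HasDerivAt.scomp (0 : ℝ) (h := fun r : ℝ => -r) (by simpa using hd)
        (hasDerivAt_neg (0 : ℝ))
      simpa using! this
    have h3 := (hasDerivAt_const (0 : ℝ) v).inner ℂ h2
    have h4 := h1.unique (h3.congr_of_eventuallyEq (Eventually.of_forall fun r => hinner r v x))
    simp only [inner_zero_right, inner_zero_left, zero_add, add_zero, inner_neg_right,
      inner_smul_left, inner_smul_right, Complex.conj_I] at h4
    have h5 : Complex.I * ⟪w, x⟫_ℂ = Complex.I * ⟪v, y⟫_ℂ := by linear_combination -h4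
    exact mul_left_cancel₀ Complex.I_ne_zero h5

end Stone

/-! ### The one-sided exponential weight, treated for both signs at once -/

section Decay

open Filter Topology

/-- The half line on which `τ ↦ exp (l τ)` decays. -/
def decaySet (l : ℝ) : Set ℝ := {τ | l * τ < 0}

/-- The function `exp (l τ)` cut off to the half line on which it decays. -/
def decay (l : ℝ) : ℝ → ℝ := (decaySet l).indicator fun τ => Real.exp (l * τ)

theorem decaySet_of_pos {l : ℝ} (hl : 0 < l) : decaySet l = Iio 0 := by
  ext τ
  simp only [decaySet, mem_ofPred_eq, mem_Iio]
  constructor <;> intro h <;> nlinarith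

theorem decaySet_of_neg {l : ℝ} (hl : l < 0) : decaySet l = Ioi 0 := by
  ext τ
  simp only [decaySet, mem_ofPred_eq, mem_Ioi]
  constructor <;> intro h <;> nlinarith

theorem setOf_sub_mem_decaySet_of_pos {l : ℝ} (hl : 0 < l) (t : ℝ) :
    {s | t - s ∈ decaySet l} = Ioi t := by
  ext s; simp [decaySet_of_pos hl]

theorem setOf_sub_mem_decaySet_of_neg {l : ℝ} (hl : l < 0) (t : ℝ) :
    {s | t - s ∈ decaySet l} = Iio t := by
  ext s; simp [decaySet_of_neg hl]

theorem setOf_sub_mem_decaySet_of_pos' {l : ℝ} (hl : 0 < l) (s : ℝ) :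
    {t | t - s ∈ decaySet l} = Iio s := by
  ext t; simp [decaySet_of_pos hl]

theorem setOf_sub_mem_decaySet_of_neg' {l : ℝ} (hl : l < 0) (s : ℝ) :
    {t | t - s ∈ decaySet l} = Ioi s := by
  ext t; simp [decaySet_of_neg hl]

theorem measurableSet_decaySet (l : ℝ) : MeasurableSet (decaySet l) :=
  measurableSet_lt (by fun_prop) (by fun_prop)

theorem measurable_decay (l : ℝ) : Measurable (decay l) :=
  Measurable.indicator (by fun_prop) (measurableSet_decaySet l)

theorem decay_nonneg (l τ : ℝ) : 0 ≤ decay l τ :=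
  indicator_nonneg (fun _ _ => (Real.exp_pos _).le) τ

theorem decay_le_one (l τ : ℝ) : decay l τ ≤ 1 :=
  indicator_le' (fun _ hτ => Real.exp_le_one_iff.2 (le_of_lt hτ)) (fun _ _ => zero_le_one) τ

theorem decay_sq (l τ : ℝ) : decay l τ ^ 2 = decay (2 * l) τ := by
  by_cases h : τ ∈ decaySet l
  · have h' : τ ∈ decaySet (2 * l) := by
      have : l * τ < 0 := h
      change 2 * l * τ < 0
      linarith
    rw [decay, decay, indicator_of_mem h, indicator_of_mem h', ← Real.exp_nat_mul]
    congr 1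
    push_cast; ring
  · have h' : τ ∉ decaySet (2 * l) := by
      intro h2
      have : 2 * l * τ < 0 := h2
      exact h (by change l * τ < 0; linarith)
    rw [decay, decay, indicator_of_notMem h, indicator_of_notMem h']
    simp

theorem integrable_decay {l : ℝ} (hl : l ≠ 0) : Integrable (decay l) := by
  rw [decay, integrable_indicator_iff (measurableSet_decaySet l)]
  rcases hl.lt_or_gt with h | h
  · rw [decaySet_of_neg h]
    exact integrableOn_exp_mul_Ioi h 0
  · rw [decaySet_of_pos h]
    exact (integrableOn_exp_mul_Iic h 0).mono_set Iio_subset_Iic_self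

theorem integral_decay {l : ℝ} (hl : l ≠ 0) : ∫ τ, decay l τ = 1 / |l| := by
  rw [decay, integral_indicator (measurableSet_decaySet l)]
  rcases hl.lt_or_gt with h | h
  · rw [decaySet_of_neg h, integral_exp_mul_Ioi h, abs_of_neg h]
    simp [neg_div, div_neg]
  · rw [decaySet_of_pos h, ← integral_Iic_eq_integral_Iio, integral_exp_mul_Iic h, abs_of_pos h]
    simp

theorem integrable_decay_sub {l : ℝ} (hl : l ≠ 0) (t : ℝ) :
    Integrable fun s => decay l (t - s) :=
  (integrable_decay hl).comp_sub_left t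

theorem integral_decay_sub {l : ℝ} (hl : l ≠ 0) (t : ℝ) : ∫ s, decay l (t - s) = 1 / |l| := by
  rw [integral_sub_left_eq_self (decay l), integral_decay hl]

/-- The half line has `s` as its right end if `l > 0` and as its left end if `l < 0`; compact
support removes the contribution at infinity, and the sign records which end remains. -/
theorem integral_deriv_of_hasCompactSupport {E : Type*} [NormedAddCommGroup E] [NormedSpace ℝ E]
    [CompleteSpace E]
    {ψ ψ' : ℝ → E} (hψ : ∀ t, HasDerivAt ψ (ψ' t) t) (hc : Continuous ψ')
    (hs : HasCompactSupport ψ) {l : ℝ} (hl : l ≠ 0) (s : ℝ) :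
    ∫ t in {t | t - s ∈ decaySet l}, ψ' t = ((SignType.sign l : ℤ) : ℝ) • ψ s := by
  have hd : deriv ψ = ψ' := funext fun t => (hψ t).deriv
  have hC : ContDiff ℝ 1 ψ :=
    contDiff_one_iff_deriv.2 ⟨fun t => (hψ t).differentiableAt, by rwa [hd]⟩
  rw [← hd]
  rcases hl.lt_or_gt with h | h
  · rw [setOf_sub_mem_decaySet_of_neg' h, hs.integral_Ioi_deriv_eq hC]
    simp [h]
  · rw [setOf_sub_mem_decaySet_of_pos' h, ← integral_Iic_eq_integral_Iio,
      hs.integral_Iic_deriv_eq hC]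
    simp [h]

theorem integral_deriv_eq_zero_of_hasCompactSupport {E : Type*} [NormedAddCommGroup E]
    [NormedSpace ℝ E] [CompleteSpace E]
    {ψ ψ' : ℝ → E} (hψ : ∀ t, HasDerivAt ψ (ψ' t) t) (hc : Continuous ψ')
    (hs : HasCompactSupport ψ) : ∫ t, ψ' t = 0 := by
  have hd : deriv ψ = ψ' := funext fun t => (hψ t).deriv
  have hC : ContDiff ℝ 1 ψ :=
    contDiff_one_iff_deriv.2 ⟨fun t => (hψ t).differentiableAt, by rwa [hd]⟩
  rw [← hd]
  exact integral_eq_zero_of_hasDerivAt_of_integrable (fun t => by rw [hd]; exact hψ t)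
    ((hC.continuous_deriv le_rfl).integrable_of_hasCompactSupport hs.deriv)
    (hC.continuous.integrable_of_hasCompactSupport hs)

theorem sq_integral_mul_le {α : Type*} [MeasurableSpace α] {μ : Measure α} {f g : α → ℝ}
    (hf : MemLp f 2 μ) (hg : MemLp g 2 μ) (hf0 : ∀ x, 0 ≤ f x) (hg0 : ∀ x, 0 ≤ g x) :
    (∫ x, f x * g x ∂μ) ^ 2 ≤ (∫ x, f x ^ 2 ∂μ) * ∫ x, g x ^ 2 ∂μ := by
  have h := integral_mul_le_Lp_mul_Lq_of_nonneg Real.HolderConjugate.two_two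
    (ae_of_all μ hf0) (ae_of_all μ hg0) (by simpa using hf) (by simpa using hg)
  simp only [Real.rpow_two, ← Real.sqrt_eq_rpow] at h
  have h0 : 0 ≤ ∫ x, f x * g x ∂μ := integral_nonneg fun x => mul_nonneg (hf0 x) (hg0 x)
  calc _ ≤ (√(∫ x, f x ^ 2 ∂μ) * √(∫ x, g x ^ 2 ∂μ)) ^ 2 := pow_le_pow_left₀ h0 h 2
    _ = _ := by
      rw [mul_pow, Real.sq_sqrt (integral_nonneg fun x => sq_nonneg _),
        Real.sq_sqrt (integral_nonneg fun x => sq_nonneg _)]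

theorem memLp_decay_sub {l : ℝ} (hl : l ≠ 0) (t : ℝ) :
    MemLp (fun s => decay l (t - s)) 2 := by
  rw [memLp_two_iff_integrable_sq]
  · simp only [decay_sq]
    exact integrable_decay_sub (by simpa using hl) t
  · exact ((measurable_decay l).comp (measurable_const.sub measurable_id)).aestronglyMeasurable

section

variable {H : Type*} [NormedAddCommGroup H] {F : ℝ → H} {l : ℝ}

theorem integrable_decay_mul_norm (hF : MemLp F 2) (hl : l ≠ 0) (t : ℝ) :
    Integrable fun s => decay l (t - s) * ‖F s‖ :=
  (memLp_decay_sub hl t).integrable_mul hF.norm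

theorem integrable_norm_sq (hF : MemLp F 2) : Integrable fun s => ‖F s‖ ^ 2 :=
  hF.integrable_norm_pow (by norm_num)

/-- Cauchy–Schwarz with the weight entirely on one factor: the square of the weight has integral `1
/ (2 |l|)`. This is the source of the bounds for the boundary data. -/
theorem sq_integral_decay_mul_norm_le (hF : MemLp F 2) (hl : l ≠ 0) (t : ℝ) :
    (∫ s, decay l (t - s) * ‖F s‖) ^ 2 ≤ 1 / (2 * |l|) * ∫ s, ‖F s‖ ^ 2 := by
  refine (sq_integral_mul_le (memLp_decay_sub hl t) hF.norm (fun s => decay_nonneg _ _)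
    fun s => norm_nonneg _).trans_eq ?_
  simp only [decay_sq]
  rw [integral_decay_sub (by simpa using hl), abs_mul, abs_two]

theorem integrable_decay_mul_norm_sq (hF : MemLp F 2) (t : ℝ) :
    Integrable fun s => decay l (t - s) * ‖F s‖ ^ 2 :=
  (integrable_norm_sq hF).bdd_mul
    ((measurable_decay l).comp (measurable_const.sub measurable_id)).aestronglyMeasurable
    (c := 1) (ae_of_all _ fun s => by
      rw [Real.norm_eq_abs, abs_of_nonneg (decay_nonneg _ _)]; exact decay_le_one _ _)

/-- Here Cauchy–Schwarz splits the weight evenly as a product of two square roots. Integrated over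
`t` by `integrable_decay_convolution_norm_sq`, this is Young's inequality with constant `1 / |l|²`.
-/
theorem sq_integral_decay_mul_norm_le' (hF : MemLp F 2) (hl : l ≠ 0) (t : ℝ) :
    (∫ s, decay l (t - s) * ‖F s‖) ^ 2 ≤ 1 / |l| * ∫ s, decay l (t - s) * ‖F s‖ ^ 2 := by
  have hm : AEStronglyMeasurable (fun s => √(decay l (t - s))) :=
    ((measurable_decay l).comp (measurable_const.sub measurable_id)).sqrt.aestronglyMeasurable
  have h1 : MemLp (fun s => √(decay l (t - s))) 2 := by
    rw [memLp_two_iff_integrable_sq hm]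
    simp only [Real.sq_sqrt (decay_nonneg _ _)]
    exact integrable_decay_sub hl t
  have h2 : MemLp (fun s => √(decay l (t - s)) * ‖F s‖) 2 := by
    have hm2 : AEStronglyMeasurable (fun s => √(decay l (t - s)) * ‖F s‖) := hm.mul hF.1.norm
    rw [memLp_two_iff_integrable_sq hm2]
    simp only [mul_pow, Real.sq_sqrt (decay_nonneg _ _)]
    exact integrable_decay_mul_norm_sq hF t
  have h := sq_integral_mul_le h1 h2 (fun s => Real.sqrt_nonneg _)
    fun s => mul_nonneg (Real.sqrt_nonneg _) (norm_nonneg _)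
  simp only [mul_pow, Real.sq_sqrt (decay_nonneg _ _), ← mul_assoc,
    Real.mul_self_sqrt (decay_nonneg _ _)] at h
  rwa [integral_decay_sub hl] at h

theorem integrable_decay_convolution_norm_sq (hF : MemLp F 2) (hl : l ≠ 0) :
    Integrable (fun t => ∫ s, decay l (t - s) * ‖F s‖ ^ 2) ∧
      ∫ t, ∫ s, decay l (t - s) * ‖F s‖ ^ 2 = 1 / |l| * ∫ s, ‖F s‖ ^ 2 := by
  have e : (fun t => ∫ s, decay l (t - s) * ‖F s‖ ^ 2)
      = convolution (fun s => ‖F s‖ ^ 2) (decay l) (ContinuousLinearMap.mul ℝ ℝ) := by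
    ext t
    simp only [convolution, ContinuousLinearMap.mul_apply', mul_comm]
  rw [e]
  refine ⟨(integrable_norm_sq hF).integrable_convolution _ (integrable_decay hl), ?_⟩
  rw [integral_convolution _ (integrable_norm_sq hF) (integrable_decay hl), integral_decay hl]
  simp [mul_comm]

end

end Decay

/-! ### The decaying solution operator on the whole line -/

section Volterra

open Filter Topology

variable {H : Type*} [NormedAddCommGroup H] [InnerProductSpace ℂ H]

theorem kernel_apply (U : ℝ → H →L[ℂ] H) (z : ℂ) (τ : ℝ) (x : H) :
    kernel U z τ x = Complex.exp (-(Complex.I * z * τ)) • U τ x := rfl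

/-- The pointwise form, tested with `φ x`, of `i u' + Ã u - z u`. -/
def weakDefect (z : ℂ) (φ : ℝ → ℝ) (x y : H) (u : ℝ → H) (t : ℝ) : ℂ :=
  -Complex.I * (((deriv φ t : ℝ) : ℂ) * ⟪x, u t⟫_ℂ) + (φ t : ℂ) * ⟪y, u t⟫_ℂ
    - z * ((φ t : ℂ) * ⟪x, u t⟫_ℂ)

theorem continuous_weakDefect {φ : ℝ → ℝ} (hφ : ContDiff ℝ ∞ φ) {u : ℝ → H} (hu : Continuous u)
    (z : ℂ) (x y : H) : Continuous (weakDefect z φ x y u) := by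
  have h1 : Continuous (deriv φ) := hφ.continuous_deriv (by simp)
  have h2 := hφ.continuous
  unfold weakDefect
  fun_prop

theorem hasCompactSupport_ofReal_mul {φ : ℝ → ℝ} (hs : HasCompactSupport φ) (g : ℝ → ℂ) :
    HasCompactSupport fun t => (φ t : ℂ) * g t :=
  (hs.comp_left (g := ((↑) : ℝ → ℂ)) Complex.ofReal_zero).mul_right

variable [CompleteSpace H] {A : H →ₗ.[ℂ] H} {U : ℝ → H →L[ℂ] H} {F : ℝ → H} {z : ℂ}

namespace IsExpGroup

theorem norm_kernel_apply (hU : IsExpGroup A U) (z : ℂ) (τ : ℝ) (x : H) :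
    ‖kernel U z τ x‖ = Real.exp (z.im * τ) * ‖x‖ := by
  rw [kernel_apply, norm_smul, hU.norm_apply, Complex.norm_exp]
  simp

theorem kernel_zero (hU : IsExpGroup A U) (z : ℂ) (x : H) : kernel U z 0 x = x := by
  simp [kernel_apply, hU.zero]

theorem kernel_add_apply (hU : IsExpGroup A U) (z : ℂ) (s t : ℝ) (x : H) :
    kernel U z (s + t) x = kernel U z s (kernel U z t x) := by
  simp only [kernel_apply, map_smul, smul_smul, hU.add_apply, ← Complex.exp_add]
  congr 2
  push_cast
  ring

theorem kernel_neg_kernel (hU : IsExpGroup A U) (z : ℂ) (t : ℝ) (x : H) :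
    kernel U z (-t) (kernel U z t x) = x := by
  rw [← hU.kernel_add_apply, neg_add_cancel, hU.kernel_zero]

theorem continuous_kernel_uncurry (hU : IsExpGroup A U) (z : ℂ) :
    Continuous fun p : ℝ × H => kernel U z p.1 p.2 := by
  simp only [kernel_apply]
  have h : Continuous fun p : ℝ × H => Complex.exp (-(Complex.I * z * (p.1 : ℂ))) := by fun_prop
  exact h.smul hU.continuous_uncurry

theorem continuous_kernel (hU : IsExpGroup A U) (z : ℂ) (x : H) :
    Continuous fun t => kernel U z t x :=
  (hU.continuous_kernel_uncurry z).comp (continuous_id.prodMk continuous_const)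

/-- The orbit of a general `v` need not be differentiable in `H`; moving the group to the domain
vector `x` makes the scalar function differentiable. -/
theorem hasDerivAt_inner_kernel (hU : IsExpGroup A U) (z : ℂ) {x y : H} (h : (x, y) ∈ A.graph)
    (v : H) (t : ℝ) :
    HasDerivAt (fun t => ⟪x, kernel U z t v⟫_ℂ)
      (-(Complex.I * z) * ⟪x, kernel U z t v⟫_ℂ + Complex.I * ⟪y, kernel U z t v⟫_ℂ) t := by
  have h1 : HasDerivAt (fun t => U (-t) x) (-(U (-t) (Complex.I • y))) t := by
    have := HasDerivAt.scomp t (h := fun r : ℝ => -r) (hU.hasDerivAt h (-t)) (hasDerivAt_neg t)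
    simpa using! this
  have h2 := h1.inner ℂ (hasDerivAt_const t v)
  have h3 : HasDerivAt (fun t : ℝ => Complex.exp (-(Complex.I * z * t)))
      (Complex.exp (-(Complex.I * z * t)) * (-(Complex.I * z * (1 : ℝ)))) t := by
    have := (((hasDerivAt_id t).ofReal_comp.const_mul (Complex.I * z)).neg).cexp
    simpa using! this
  have h4 := h3.mul h2
  have e : ∀ t w, ⟪w, U t v⟫_ℂ = ⟪U (-t) w, v⟫_ℂ := fun t w => by
    rw [hU.inner_apply, neg_neg]
  refine (h4.congr_of_eventuallyEq (Eventually.of_forall fun s => ?_)).congr_deriv ?_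
  · simp only [kernel_apply, inner_smul_right, e]
    rfl
  · simp only [kernel_apply, inner_smul_right, e, inner_zero_right, inner_neg_left, map_smul,
      inner_smul_left, Complex.conj_I]
    push_cast
    ring

end IsExpGroup

/-- The solution on `ℝ` of `i u' + Ã u - z u = F` that decays at infinity if `F` does. -/
def volterra (U : ℝ → H →L[ℂ] H) (z : ℂ) (F : ℝ → H) (t : ℝ) : H :=
  ((((SignType.sign z.im : ℤ) : ℝ) : ℂ) * Complex.I) •
    ∫ s in {s | t - s ∈ decaySet z.im}, kernel U z (t - s) (F s)

theorem sign_sq {l : ℝ} (hl : l ≠ 0) : ((SignType.sign l : ℤ) : ℝ) ^ 2 = 1 := by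
  rcases hl.lt_or_gt with h | h <;> simp [h]

theorem measurableSet_setOf_sub_mem_decaySet (l t : ℝ) :
    MeasurableSet {s | t - s ∈ decaySet l} :=
  (measurable_const.sub measurable_id) (measurableSet_decaySet l)

theorem norm_indicator_kernel (hU : IsExpGroup A U) (z : ℂ) (F : ℝ → H) (t s : ℝ) :
    ‖{s | t - s ∈ decaySet z.im}.indicator (fun s => kernel U z (t - s) (F s)) s‖
      = decay z.im (t - s) * ‖F s‖ := by
  by_cases h : t - s ∈ decaySet z.im
  · have h' : s ∈ {s | t - s ∈ decaySet z.im} := h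
    rw [indicator_of_mem h', hU.norm_kernel_apply, decay, indicator_of_mem h]
  · have h' : s ∉ {s | t - s ∈ decaySet z.im} := h
    rw [indicator_of_notMem h', decay, indicator_of_notMem h]
    simp

theorem aestronglyMeasurable_kernel_apply (hU : IsExpGroup A U) (z : ℂ)
    (hF : AEStronglyMeasurable F) (t : ℝ) :
    AEStronglyMeasurable (fun s => kernel U z (t - s) (F s)) :=
  Continuous.comp_aestronglyMeasurable (g := fun p : ℝ × H => kernel U z p.1 p.2)
    (f := fun s => (t - s, F s)) (hU.continuous_kernel_uncurry z)
    (((continuous_const.sub continuous_id).aestronglyMeasurable).prodMk hF)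

theorem integrableOn_kernel (hU : IsExpGroup A U) (hz : z.im ≠ 0) (hF : MemLp F 2) (t : ℝ) :
    IntegrableOn (fun s => kernel U z (t - s) (F s)) {s | t - s ∈ decaySet z.im} := by
  rw [← integrable_indicator_iff (measurableSet_setOf_sub_mem_decaySet _ _)]
  refine (integrable_decay_mul_norm hF hz t).mono'
    ((aestronglyMeasurable_kernel_apply hU z hF.1 t).indicator
      (measurableSet_setOf_sub_mem_decaySet _ _)) (ae_of_all _ fun s => ?_)
  rw [norm_indicator_kernel hU]

theorem norm_volterra_le (hU : IsExpGroup A U) (hz : z.im ≠ 0) (F : ℝ → H) (t : ℝ) :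
    ‖volterra U z F t‖ ≤ ∫ s, decay z.im (t - s) * ‖F s‖ := by
  rw [volterra, norm_smul, ← integral_indicator (measurableSet_setOf_sub_mem_decaySet _ _)]
  have h1 : ‖((((SignType.sign z.im : ℤ) : ℝ) : ℂ) * Complex.I)‖ = 1 := by
    rcases hz.lt_or_gt with h | h <;> simp [h]
  rw [h1, one_mul]
  refine (norm_integral_le_integral_norm _).trans_eq ?_
  simp only [norm_indicator_kernel hU]

theorem norm_volterra_sq_le (hU : IsExpGroup A U) (hz : z.im ≠ 0) (hF : MemLp F 2) (t : ℝ) :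
    ‖volterra U z F t‖ ^ 2 ≤ 1 / (2 * |z.im|) * ∫ s, ‖F s‖ ^ 2 :=
  (pow_le_pow_left₀ (norm_nonneg _) (norm_volterra_le hU hz F t) 2).trans
    (sq_integral_decay_mul_norm_le hF hz t)

/-- The factorization `kernel (t - s) = kernel t ∘ kernel (-s)` turns the integral into a bounded
operator applied to a primitive of a fixed function, so joint continuity of the kernel finishes the
argument. -/
theorem continuous_volterra (hU : IsExpGroup A U) (hz : z.im ≠ 0) (hF : MemLp F 2) :
    Continuous (volterra U z F) := by
  have hint : ∀ t, IntegrableOn (fun s => kernel U z (-s) (F s))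
      {s | t - s ∈ decaySet z.im} := by
    intro t
    refine ((kernel U z (-t)).integrable_comp (integrableOn_kernel hU hz hF t)).congr
      (ae_of_all _ fun s => ?_)
    simp only
    rw [sub_eq_add_neg, hU.kernel_add_apply, hU.kernel_neg_kernel]
  have e : volterra U z F = fun t => ((((SignType.sign z.im : ℤ) : ℝ) : ℂ) * Complex.I) •
      kernel U z t (∫ s in {s | t - s ∈ decaySet z.im}, kernel U z (-s) (F s)) := by
    ext t
    rw [volterra, ← ContinuousLinearMap.integral_comp_comm _ (hint t)]
    congr 2
    ext s
    rw [sub_eq_add_neg, hU.kernel_add_apply]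
  have hc : Continuous fun t => ∫ s in {s | t - s ∈ decaySet z.im}, kernel U z (-s) (F s) := by
    rw [continuous_iff_continuousAt]
    intro t
    rcases hz.lt_or_gt with h | h
    · simp only [setOf_sub_mem_decaySet_of_neg h] at hint ⊢
      -- The half line is enlarged by one so that `t` becomes an interior point.
      exact (IntegrableOn.continuousOn_Iic_primitive_Iio (hint (t + 1))).continuousAt
        (Iic_mem_nhds (by linarith))
    · simp only [setOf_sub_mem_decaySet_of_pos h] at hint ⊢
      exact (IntegrableOn.continuousOn_Ici_primitive_Ioi (hint (t - 1))).continuousAt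
        (Ici_mem_nhds (by linarith))
  rw [e]
  exact ((hU.continuous_kernel_uncurry z).comp (continuous_id.prodMk hc)).const_smul _

theorem memLp_volterra (hU : IsExpGroup A U) (hz : z.im ≠ 0) (hF : MemLp F 2) :
    MemLp (volterra U z F) 2 := by
  rw [memLp_two_iff_integrable_sq_norm (continuous_volterra hU hz hF).aestronglyMeasurable]
  refine ((integrable_decay_convolution_norm_sq hF hz).1.const_mul (1 / |z.im|)).mono'
    ((continuous_volterra hU hz hF).norm.pow 2).aestronglyMeasurable (ae_of_all _ fun t => ?_)
  rw [Real.norm_eq_abs, abs_of_nonneg (sq_nonneg _)]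
  exact (pow_le_pow_left₀ (norm_nonneg _) (norm_volterra_le hU hz F t) 2).trans
    (sq_integral_decay_mul_norm_le' hF hz t)

theorem integral_norm_volterra_sq_le (hU : IsExpGroup A U) (hz : z.im ≠ 0) (hF : MemLp F 2) :
    ∫ t, ‖volterra U z F t‖ ^ 2 ≤ 1 / |z.im| ^ 2 * ∫ s, ‖F s‖ ^ 2 := by
  obtain ⟨h1, h2⟩ := integrable_decay_convolution_norm_sq hF hz
  calc ∫ t, ‖volterra U z F t‖ ^ 2
      ≤ ∫ t, 1 / |z.im| * ∫ s, decay z.im (t - s) * ‖F s‖ ^ 2 :=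
        integral_mono (integrable_norm_sq (memLp_volterra hU hz hF)) (h1.const_mul _) fun t =>
          (pow_le_pow_left₀ (norm_nonneg _) (norm_volterra_le hU hz F t) 2).trans
            (sq_integral_decay_mul_norm_le' hF hz t)
    _ = 1 / |z.im| ^ 2 * ∫ s, ‖F s‖ ^ 2 := by
        rw [integral_const_mul, h2, ← mul_assoc]
        congr 1
        ring

/-- The homogeneous equation makes the tested defect a total derivative, up to the factor `i`. Its
integral is thus zero over `ℝ` and a boundary term over a half line. -/
theorem hasDerivAt_mul_inner_kernel (hU : IsExpGroup A U) (z : ℂ) {x y : H}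
    (h : (x, y) ∈ A.graph) {φ : ℝ → ℝ} (hφ : ContDiff ℝ ∞ φ) (v : H) (s t : ℝ) :
    HasDerivAt (fun t => (φ t : ℂ) * ⟪x, kernel U z (t - s) v⟫_ℂ)
      (Complex.I * weakDefect z φ x y (fun t => kernel U z (t - s) v) t) t := by
  have h1 : HasDerivAt φ (deriv φ t) t := (hφ.differentiable (by simp) t).hasDerivAt
  have h2 := h1.ofReal_comp.mul ((hU.hasDerivAt_inner_kernel z h v (t - s)).comp_sub_const t s)
  refine h2.congr_deriv ?_
  rw [weakDefect]
  linear_combination (((deriv φ t : ℝ) : ℂ) * ⟪x, kernel U z (t - s) v⟫_ℂ) * Complex.I_mul_I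

theorem integral_weakDefect_kernel (hU : IsExpGroup A U) (z : ℂ) {x y : H}
    (h : (x, y) ∈ A.graph) {φ : ℝ → ℝ} (hφ : ContDiff ℝ ∞ φ) (hs : HasCompactSupport φ)
    (v : H) (s : ℝ) : ∫ t, weakDefect z φ x y (fun t => kernel U z (t - s) v) t = 0 := by
  have hu : Continuous fun t => kernel U z (t - s) v :=
    (hU.continuous_kernel z v).comp (continuous_id.sub continuous_const)
  have h1 := integral_deriv_eq_zero_of_hasCompactSupport
    (hasDerivAt_mul_inner_kernel hU z h hφ v s)
    (continuous_const.mul (continuous_weakDefect hφ hu z x y)) (hasCompactSupport_ofReal_mul hs _)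
  rw [integral_const_mul] at h1
  exact (mul_eq_zero.1 h1).resolve_left Complex.I_ne_zero

theorem integral_weakDefect_kernel_decaySet (hU : IsExpGroup A U) (hz : z.im ≠ 0) {x y : H}
    (h : (x, y) ∈ A.graph) {φ : ℝ → ℝ} (hφ : ContDiff ℝ ∞ φ) (hs : HasCompactSupport φ)
    (v : H) (s : ℝ) :
    ∫ t in {t | t - s ∈ decaySet z.im}, weakDefect z φ x y (fun t => kernel U z (t - s) v) t
      = -(((((SignType.sign z.im : ℤ) : ℝ) : ℂ) * Complex.I)) * ((φ s : ℂ) * ⟪x, v⟫_ℂ) := by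
  have hu : Continuous fun t => kernel U z (t - s) v :=
    (hU.continuous_kernel z v).comp (continuous_id.sub continuous_const)
  have h1 := integral_deriv_of_hasCompactSupport
    (hasDerivAt_mul_inner_kernel hU z h hφ v s)
    (continuous_const.mul (continuous_weakDefect hφ hu z x y)) (hasCompactSupport_ofReal_mul hs _)
    hz s
  rw [integral_const_mul, sub_self, hU.kernel_zero, Complex.real_smul] at h1
  linear_combination (-Complex.I) * h1 + (∫ t in {t | t - s ∈ decaySet z.im},
    weakDefect z φ x y (fun t => kernel U z (t - s) v) t) * Complex.I_mul_I

/-- By Fubini the `t` integral may be done first. For each `s` it is the half line integral of a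
total derivative, leaving the boundary term `-c φ(s) ⟪x, F s⟫`; the prefactor `c = ±i` of `volterra`
cancels it because `c · (-c) = 1`. -/
theorem integral_weakDefect_volterra (hU : IsExpGroup A U) (hz : z.im ≠ 0) (hF : MemLp F 2)
    {x y : H} (h : (x, y) ∈ A.graph) {φ : ℝ → ℝ} (hφ : ContDiff ℝ ∞ φ)
    (hs : HasCompactSupport φ) :
    ∫ t, weakDefect z φ x y (volterra U z F) t = ∫ s, (φ s : ℂ) * ⟪x, F s⟫_ℂ := by
  set c : ℂ := (((SignType.sign z.im : ℤ) : ℝ) : ℂ) * Complex.I with hc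
  have hcc : c * -c = 1 := by
    have h1 := sign_sq hz
    have h2 : (((SignType.sign z.im : ℤ) : ℝ) : ℂ) ^ 2 = 1 := by exact_mod_cast h1
    rw [hc]
    linear_combination h2 - (((SignType.sign z.im : ℤ) : ℝ) : ℂ) ^ 2 * Complex.I_mul_I
  have hφ' : Continuous (deriv φ) := hφ.continuous_deriv (by simp)
  let S : Set (ℝ × ℝ) := {p | p.1 - p.2 ∈ decaySet z.im}
  have hS : MeasurableSet S := (measurable_fst.sub measurable_snd) (measurableSet_decaySet _)
  let G : ℝ × ℝ → ℂ := S.indicator fun p =>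
    weakDefect z φ x y (fun t => kernel U z (t - p.2) (F p.2)) p.1
  have hGm : AEStronglyMeasurable G (volume.prod volume) := by
    refine AEStronglyMeasurable.indicator ?_ hS
    have hk : AEStronglyMeasurable (fun p : ℝ × ℝ => kernel U z (p.1 - p.2) (F p.2))
        (volume.prod volume) :=
      Continuous.comp_aestronglyMeasurable (g := fun p : ℝ × H => kernel U z p.1 p.2)
        (f := fun p : ℝ × ℝ => (p.1 - p.2, F p.2)) (hU.continuous_kernel_uncurry z)
        (((continuous_fst.sub continuous_snd).aestronglyMeasurable).prodMk hF.1.comp_snd)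
    have hx : ∀ w : H, AEStronglyMeasurable
        (fun p : ℝ × ℝ => ⟪w, kernel U z (p.1 - p.2) (F p.2)⟫_ℂ) (volume.prod volume) :=
      fun w => (aestronglyMeasurable_const (b := w)).inner hk
    have h1 : AEStronglyMeasurable (fun p : ℝ × ℝ => ((deriv φ p.1 : ℝ) : ℂ))
        (volume.prod volume) :=
      (Complex.continuous_ofReal.comp (hφ'.comp continuous_fst)).aestronglyMeasurable
    have h2 : AEStronglyMeasurable (fun p : ℝ × ℝ => ((φ p.1 : ℝ) : ℂ)) (volume.prod volume) :=
      (Complex.continuous_ofReal.comp (hφ.continuous.comp continuous_fst)).aestronglyMeasurable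
    exact (((h1.mul (hx x)).const_mul _).add (h2.mul (hx y))).sub ((h2.mul (hx x)).const_mul z)
  -- A compactly supported majorant in `t`; the remaining `s` integral is bounded uniformly in `t`
  -- by Cauchy–Schwarz, which gives integrability on the product.
  let C : ℝ → ℝ := fun t => |deriv φ t| * ‖x‖ + |φ t| * ‖y‖ + ‖z‖ * (|φ t| * ‖x‖)
  have hCc : Continuous C := by
    have := hφ.continuous
    fun_prop
  have hCs : HasCompactSupport C := by
    have h1 := hs.deriv.norm
    have h2 := hs.norm
    exact ((h1.mul_right).add h2.mul_right).add (h2.mul_right.mul_left)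
  have hC0 : ∀ t, 0 ≤ C t := fun t => by positivity
  have hGb : ∀ t s, ‖G (t, s)‖ ≤ C t * (decay z.im (t - s) * ‖F s‖) := by
    intro t s
    by_cases hts : t - s ∈ decaySet z.im
    · have hm : (t, s) ∈ S := hts
      have hn : ∀ w : H, ‖⟪w, kernel U z (t - s) (F s)⟫_ℂ‖
          ≤ ‖w‖ * (decay z.im (t - s) * ‖F s‖) := by
        intro w
        refine (norm_inner_le_norm _ _).trans_eq ?_
        rw [hU.norm_kernel_apply, decay, indicator_of_mem hts]
      simp only [G, indicator_of_mem hm, weakDefect, C]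
      set D := decay z.im (t - s) * ‖F s‖
      refine (norm_sub_le _ _).trans ((add_le_add_left (norm_add_le _ _) _).trans ?_)
      simp only [norm_mul, norm_neg, Complex.norm_I, one_mul, Complex.norm_real, Real.norm_eq_abs]
      have h1 := hn x
      have h2 := hn y
      calc _ ≤ |deriv φ t| * (‖x‖ * D) + |φ t| * (‖y‖ * D) + ‖z‖ * (|φ t| * (‖x‖ * D)) := by
            gcongr
        _ = _ := by ring
    · have hm : (t, s) ∉ S := hts
      simp only [G, indicator_of_notMem hm, norm_zero]
      exact mul_nonneg (hC0 t) (mul_nonneg (decay_nonneg _ _) (norm_nonneg _))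
  have hGt : ∀ t, AEStronglyMeasurable (fun s => G (t, s)) := by
    intro t
    have e : (fun s => G (t, s)) = {s | t - s ∈ decaySet z.im}.indicator fun s =>
        weakDefect z φ x y (fun t => kernel U z (t - s) (F s)) t := rfl
    rw [e]
    refine AEStronglyMeasurable.indicator ?_ (measurableSet_setOf_sub_mem_decaySet _ _)
    have hx : ∀ w : H, AEStronglyMeasurable (fun s => ⟪w, kernel U z (t - s) (F s)⟫_ℂ) :=
      fun w => (aestronglyMeasurable_const (b := w)).inner
        (aestronglyMeasurable_kernel_apply hU z hF.1 t)
    exact ((((hx x).const_mul _).const_mul _).add ((hx y).const_mul _)).sub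
      (((hx x).const_mul _).const_mul z)
  have hGi : ∀ t, Integrable (fun s => G (t, s)) := fun t =>
    ((integrable_decay_mul_norm hF hz t).const_mul (C t)).mono' (hGt t)
      (ae_of_all _ fun s => hGb t s)
  have hG : Integrable G (volume.prod volume) := by
    rw [integrable_prod_iff hGm]
    refine ⟨ae_of_all _ hGi, ?_⟩
    refine ((hCc.integrable_of_hasCompactSupport hCs).mul_const
      (√(1 / (2 * |z.im|) * ∫ s, ‖F s‖ ^ 2))).mono' hGm.norm.integral_prod_right'
      (ae_of_all _ fun t => ?_)
    rw [Real.norm_eq_abs, abs_of_nonneg (integral_nonneg fun s => norm_nonneg _)]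
    calc ∫ s, ‖G (t, s)‖ ≤ ∫ s, C t * (decay z.im (t - s) * ‖F s‖) :=
          integral_mono (hGi t).norm ((integrable_decay_mul_norm hF hz t).const_mul _) (hGb t)
      _ = C t * ∫ s, decay z.im (t - s) * ‖F s‖ := integral_const_mul _ _
      _ ≤ _ := by
          refine mul_le_mul_of_nonneg_left ?_ (hC0 t)
          exact Real.le_sqrt_of_sq_le (sq_integral_decay_mul_norm_le hF hz t)
  have hleft : ∀ t, weakDefect z φ x y (volterra U z F) t = c * ∫ s, G (t, s) := by
    intro t
    have hi := integrableOn_kernel hU hz hF t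
    have e : ∫ s, G (t, s) = ∫ s in {s | t - s ∈ decaySet z.im},
        weakDefect z φ x y (fun t => kernel U z (t - s) (F s)) t := by
      rw [← integral_indicator (measurableSet_setOf_sub_mem_decaySet _ _)]
      rfl
    have hx : ∀ w : H, Integrable (fun s => ⟪w, kernel U z (t - s) (F s)⟫_ℂ)
        (volume.restrict {s | t - s ∈ decaySet z.im}) := fun w => hi.const_inner w
    have hw : ∀ w : H, ⟪w, volterra U z F t⟫_ℂ = c *
        ∫ s in {s | t - s ∈ decaySet z.im}, ⟪w, kernel U z (t - s) (F s)⟫_ℂ := by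
      intro w
      rw [volterra, inner_smul_right, integral_inner hi]
    rw [e]
    simp only [weakDefect]
    rw [integral_sub, integral_add, integral_const_mul, integral_const_mul, integral_const_mul,
      integral_const_mul, integral_const_mul, hw, hw]
    · ring
    · exact ((hx x).const_mul _).const_mul _
    · exact (hx y).const_mul _
    · exact (((hx x).const_mul _).const_mul _).add ((hx y).const_mul _)
    · exact ((hx x).const_mul _).const_mul _
  have hright : ∀ s, ∫ t, G (t, s) = -c * ((φ s : ℂ) * ⟪x, F s⟫_ℂ) := by
    intro s
    rw [← integral_weakDefect_kernel_decaySet hU hz h hφ hs (F s) s, ← integral_indicator]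
    · rfl
    · exact (measurable_id.sub measurable_const) (measurableSet_decaySet _)
  calc ∫ t, weakDefect z φ x y (volterra U z F) t = c * ∫ t, ∫ s, G (t, s) := by
        rw [← integral_const_mul]
        exact integral_congr_ae (ae_of_all _ hleft)
    _ = c * ∫ s, ∫ t, G (t, s) := by rw [integral_integral_swap (f := fun t s => G (t, s)) hG]
    _ = ∫ s, (φ s : ℂ) * ⟪x, F s⟫_ℂ := by
        simp only [hright]
        rw [integral_const_mul, ← mul_assoc, hcc, one_mul]

end Volterra

/-! ### Weak solutions of the homogeneous equation -/

section Homogeneous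

open Filter Topology

variable {H : Type*} [NormedAddCommGroup H]

theorem memLp_indicator_coe {J : Set ℝ} (hJ : MeasurableSet J) (u : L2On H J) :
    MemLp (J.indicator u) 2 :=
  (memLp_indicator_iff_restrict hJ).2 (Lp.memLp u)

variable [InnerProductSpace ℂ H]

theorem setIntegral_mul_inner_eq {J : Set ℝ} (hJ : MeasurableSet J) (c : ℝ → ℝ) (x : H)
    (u : ℝ → H) :
    ∫ t in J, (c t : ℂ) * ⟪x, u t⟫_ℂ = ∫ t, (c t : ℂ) * ⟪x, J.indicator u t⟫_ℂ := by
  rw [← integral_indicator hJ]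
  congr 1
  ext t
  by_cases h : t ∈ J
  · rw [indicator_of_mem h, indicator_of_mem h]
  · rw [indicator_of_notMem h, indicator_of_notMem h]
    simp

variable [CompleteSpace H] {A : H →ₗ.[ℂ] H} {U : ℝ → H →L[ℂ] H} {z : ℂ}

theorem inner_convolution_eq {J : Set ℝ} (hJ : MeasurableSet J) {g : ℝ → ℝ} (hg : Continuous g)
    (hs : HasCompactSupport g) (x : H) (u : L2On H J) (s : ℝ) :
    ⟪x, convolution g (J.indicator u) (ContinuousLinearMap.lsmul ℝ ℝ) volume s⟫_ℂ
      = ∫ t in J, (g (s - t) : ℂ) * ⟪x, u t⟫_ℂ := by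
  have hloc : LocallyIntegrable (J.indicator u) :=
    (memLp_indicator_coe hJ u).locallyIntegrable (by norm_num)
  have hi : Integrable fun t => g (s - t) • J.indicator u t :=
    hloc.integrable_smul_left_of_hasCompactSupport (hg.comp (continuous_const.sub continuous_id))
      (hs.comp_homeomorph (Homeomorph.subLeft s))
  rw [convolution_eq_swap, setIntegral_mul_inner_eq hJ fun t => g (s - t)]
  simp only [ContinuousLinearMap.lsmul_apply]
  rw [← integral_inner hi]
  congr 1
  ext t
  rw [inner_smul_right_eq_smul]
  simp

/-- The weak equation is tested with `t ↦ ρ (s - t)`, whose derivative is `-ρ' (s - t)`; this is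
admissible where the ball of radius `δ` around `s` stays in `J`. The mollified function thus
satisfies the equation pointwise. -/
theorem IsWeakSolution.inner_convolution {J : Set ℝ} (hJ : IsOpen J) {u g : L2On H J}
    (hu : IsWeakSolution A J u g) {ρ : ℝ → ℝ} (hρ : ContDiff ℝ ∞ ρ) (hs : HasCompactSupport ρ)
    {s δ : ℝ} (hδ : Function.support ρ ⊆ Metric.closedBall 0 δ) (hsJ : Metric.closedBall s δ ⊆ J)
    {x y : H} (hxy : (x, y) ∈ A.graph) :
    Complex.I * ⟪x, convolution (deriv ρ) (J.indicator u) (ContinuousLinearMap.lsmul ℝ ℝ)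
        volume s⟫_ℂ
      + ⟪y, convolution ρ (J.indicator u) (ContinuousLinearMap.lsmul ℝ ℝ) volume s⟫_ℂ
      = ⟪x, convolution ρ (J.indicator g) (ContinuousLinearMap.lsmul ℝ ℝ) volume s⟫_ℂ := by
  obtain ⟨x', rfl, rfl⟩ := (LinearPMap.mem_graph_iff A).1 hxy
  have hρ' : Continuous (deriv ρ) := hρ.continuous_deriv (by simp)
  have h := hu (fun t => ρ (s - t)) (hρ.comp (contDiff_const.sub contDiff_id))
    (hs.comp_homeomorph (Homeomorph.subLeft s)) (by
      refine (closure_minimal (fun t ht => ?_) Metric.isClosed_closedBall).trans hsJ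
      have h1 : s - t ∈ Metric.closedBall (0 : ℝ) δ := hδ ht
      rw [Metric.mem_closedBall, dist_eq_norm] at h1 ⊢
      rwa [norm_sub_rev, ← sub_zero (s - t)]) x'
  have hd : ∀ t, deriv (fun t => ρ (s - t)) t = -deriv ρ (s - t) := fun t =>
    deriv_comp_const_sub _ _ _
  simp only [hd] at h
  rw [inner_convolution_eq hJ.measurableSet hρ' hs.deriv,
    inner_convolution_eq hJ.measurableSet hρ.continuous hs,
    inner_convolution_eq hJ.measurableSet hρ.continuous hs, ← h]
  simp only [Complex.ofReal_neg, neg_mul, integral_neg]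
  ring

/-- Variation of constants: undoing the evolution leaves a function that is weakly constant. The
equation is used with the test vector `U s x`, which stays in the domain. -/
theorem IsExpGroup.hasDerivAt_inner_kernel_neg (hU : IsExpGroup A U) {w : ℝ → H} {w' : H} {s : ℝ}
    (hw : HasDerivAt w w' s)
    (heq : ∀ x y, (x, y) ∈ A.graph → Complex.I * ⟪x, w'⟫_ℂ + ⟪y, w s⟫_ℂ = z * ⟪x, w s⟫_ℂ)
    {x y : H} (hxy : (x, y) ∈ A.graph) :
    HasDerivAt (fun s => ⟪x, kernel U z (-s) (w s)⟫_ℂ) 0 s := by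
  have h2 := (hU.hasDerivAt hxy s).inner ℂ hw
  have h3 : HasDerivAt (fun t : ℝ => Complex.exp (-(Complex.I * z * ((-t : ℝ) : ℂ))))
      (Complex.exp (-(Complex.I * z * ((-s : ℝ) : ℂ))) * (Complex.I * z)) s := by
    have := (((hasDerivAt_neg s).ofReal_comp.const_mul (Complex.I * z)).neg).cexp
    simpa using! this
  have h4 := h3.mul h2
  refine (h4.congr_of_eventuallyEq (Eventually.of_forall fun t => ?_)).congr_deriv ?_
  · simp only [kernel_apply, inner_smul_right, hU.inner_apply]
    rfl
  · have h5 := heq _ _ (hU.apply_mem_graph hxy s)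
    rw [map_smul, inner_smul_left, Complex.conj_I]
    linear_combination (-Complex.I * Complex.exp (-(Complex.I * z * ((-s : ℝ) : ℂ)))) * h5
      + (Complex.exp (-(Complex.I * z * ((-s : ℝ) : ℂ)))) * ⟪U s x, w'⟫_ℂ * Complex.I_mul_I

/-- A square integrable weak solution of `i u' + Ã u = z u` on an open interval is
`t ↦ e^{-i(z - Ã)t} c` for some `c`. -/
theorem IsWeakSolution.exists_ae_eq_kernel (hU : IsExpGroup A U)
    (hA : Dense (A.domain : Set H)) {J : Set ℝ} (hJ : IsOpen J) (hJc : J.OrdConnected)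
    {u : L2On H J} (hu : IsWeakSolution A J u (z • u)) :
    ∃ c : H, u =ᵐ[volume.restrict J] fun t => kernel U z t c := by
  set v := J.indicator u with hv
  have hloc : LocallyIntegrable v :=
    (memLp_indicator_coe hJ.measurableSet u).locallyIntegrable (by norm_num)
  -- The fixed ratio `2` of outer to inner radius is what almost everywhere convergence of the
  -- mollifications requires.
  let φ : ℕ → ContDiffBump (0 : ℝ) := fun n =>
    ⟨1 / ((n : ℝ) + 1), 2 * (1 / ((n : ℝ) + 1)), by positivity, by
      have : 0 < 1 / ((n : ℝ) + 1) := by positivity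
      linarith⟩
  have hφ0 : Tendsto (fun n => (φ n).rOut) atTop (𝓝 0) := by
    have := (tendsto_one_div_add_atTop_nhds_zero_nat (𝕜 := ℝ)).const_mul 2
    rw [mul_zero] at this
    exact this
  let w : ℕ → ℝ → H := fun n =>
    convolution ((φ n).normed volume) v (ContinuousLinearMap.lsmul ℝ ℝ) volume
  have hlim : ∀ᵐ t, Tendsto (fun n => w n t) atTop (𝓝 (v t)) :=
    ContDiffBump.ae_convolution_tendsto_right_of_locallyIntegrable (K := 2) hφ0
      (Eventually.of_forall fun n => le_rfl) hloc
  have hsmul : ∀ (n : ℕ) (s : ℝ) (x : H),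
      ⟪x, convolution ((φ n).normed volume) (J.indicator (z • u : L2On H J))
        (ContinuousLinearMap.lsmul ℝ ℝ) volume s⟫_ℂ = z * ⟪x, w n s⟫_ℂ := by
    intro n s x
    have hc : Continuous ((φ n).normed volume) := (φ n).continuous_normed
    have hs := (φ n).hasCompactSupport_normed (μ := volume)
    simp only [w, hv]
    rw [inner_convolution_eq hJ.measurableSet hc hs, inner_convolution_eq hJ.measurableSet hc hs,
      integral_mul_inner_smul fun t => (φ n).normed volume (s - t)]
  have hderiv : ∀ n s, Metric.closedBall s (φ n).rOut ⊆ J → ∀ x y, (x, y) ∈ A.graph →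
      HasDerivAt (fun s => ⟪x, kernel U z (-s) (w n s)⟫_ℂ) 0 s := by
    intro n s hs x y hxy
    have hρ : ContDiff ℝ ∞ ((φ n).normed volume) := (φ n).contDiff_normed
    have hcs := (φ n).hasCompactSupport_normed (μ := volume)
    refine hU.hasDerivAt_inner_kernel_neg
      (hcs.hasDerivAt_convolution_left (ContinuousLinearMap.lsmul ℝ ℝ)
        (hρ.of_le (by simp)) hloc s) (fun x y hxy => ?_) hxy
    rw [← hsmul]
    refine hu.inner_convolution hJ hρ hcs ?_ hs hxy
    rw [(φ n).support_normed_eq]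
    exact Metric.ball_subset_closedBall
  have hconst : ∀ s ∈ J, ∀ t ∈ J, Tendsto (fun n => w n s) atTop (𝓝 (v s)) →
      Tendsto (fun n => w n t) atTop (𝓝 (v t)) →
      kernel U z (-s) (v s) = kernel U z (-t) (v t) := by
    intro s hs t ht hls hlt
    have hst : uIcc s t ⊆ J := hJc.uIcc_subset hs ht
    -- Mollification radii below `δ` are admissible along the whole segment from `s` to `t`, so the
    -- weak derivative vanishes on it before the limit is taken.
    obtain ⟨δ, hδ, hδJ⟩ := isCompact_uIcc.exists_cthickening_subset_open hJ hst
    have hev : ∀ᶠ n in atTop, (φ n).rOut < δ := hφ0.eventually_lt_const hδ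
    apply hA.eq_of_inner_right ℂ
    intro x hx
    have hxy := LinearPMap.mem_graph A ⟨x, hx⟩
    have htend : ∀ r, Tendsto (fun n => w n r) atTop (𝓝 (v r)) →
        Tendsto (fun n => ⟪x, kernel U z (-r) (w n r)⟫_ℂ) atTop
          (𝓝 ⟪x, kernel U z (-r) (v r)⟫_ℂ) := fun r hr =>
      ((continuous_const.inner continuous_id).tendsto _).comp
        (((kernel U z (-r)).continuous.tendsto _).comp hr)
    refine tendsto_nhds_unique_of_eventuallyEq (htend s hls) (htend t hlt) ?_
    filter_upwards [hev] with n hn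
    have hb : ∀ r ∈ uIcc s t, Metric.closedBall r (φ n).rOut ⊆ J := fun r hr =>
      ((Metric.closedBall_subset_closedBall hn.le).trans
        (Metric.closedBall_subset_cthickening hr δ)).trans hδJ
    have hle := (convex_uIcc s t).norm_image_sub_le_of_norm_hasDerivWithin_le (C := 0)
      (fun r hr => (hderiv n r (hb r hr) x _ hxy).hasDerivWithinAt) (fun r _ => by simp)
      right_mem_uIcc left_mem_uIcc
    rw [zero_mul] at hle
    exact sub_eq_zero.1 (norm_le_zero_iff.1 hle)
  by_cases hex : ∃ s ∈ J, Tendsto (fun n => w n s) atTop (𝓝 (v s))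
  · obtain ⟨s, hs, hls⟩ := hex
    refine ⟨kernel U z (-s) (v s), ?_⟩
    filter_upwards [ae_restrict_of_ae hlim, ae_restrict_mem hJ.measurableSet] with t hlt ht
    rw [hconst s hs t ht hls hlt, ← hU.kernel_add_apply, add_neg_cancel, hU.kernel_zero, hv,
      indicator_of_mem ht]
  -- With no convergence point in `J`, almost everywhere convergence leaves nothing to check.
  · refine ⟨0, ?_⟩
    filter_upwards [ae_restrict_of_ae hlim, ae_restrict_mem hJ.measurableSet] with t hlt ht
    exact absurd ⟨t, ht, hlt⟩ hex

end Homogeneous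

/-! ### From unique solvability to a bounded resolvent -/

section Resolvent

variable {E : Type*} [NormedAddCommGroup E] [NormedSpace ℂ E]

theorem IsResolventAt.apply_eq {T : E →ₗ.[ℂ] E} {z : ℂ} {R : E →L[ℂ] E} (hR : IsResolventAt T z R)
    {u f : E} (h : (u, z • u + f) ∈ T.graph) : R f = u := by
  obtain ⟨u', rfl, h2⟩ := (LinearPMap.mem_graph_iff T).1 h
  simp only at h2
  have := hR.2 u'
  rwa [h2, add_sub_cancel_left] at this

/-- Injectivity makes the chosen solution the only one, hence linear in the datum; the a priori
bound makes it continuous. -/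
theorem exists_isResolventAt {T : E →ₗ.[ℂ] E} {z : ℂ} (C : ℝ)
    (hinj : ∀ u, (u, z • u) ∈ T.graph → u = 0)
    (hsurj : ∀ f, ∃ u, (u, z • u + f) ∈ T.graph ∧ ‖u‖ ≤ C * ‖f‖) :
    ∃ R : E →L[ℂ] E, IsResolventAt T z R := by
  choose r hr hrC using hsurj
  have huniq : ∀ u f, (u, z • u + f) ∈ T.graph → r f = u := by
    intro u f h
    have h1 := T.graph.sub_mem (hr f) h
    have h2 : ((r f, z • r f + f) : E × E) - (u, z • u + f) = (r f - u, z • (r f - u)) := by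
      rw [Prod.mk_sub_mk, smul_sub]
      congr 1
      abel
    rw [h2] at h1
    exact sub_eq_zero.1 (hinj _ h1)
  let R : E →ₗ[ℂ] E :=
    { toFun := r
      map_add' := fun f g => huniq _ _ (by
        have h1 := T.graph.add_mem (hr f) (hr g)
        rw [Prod.mk_add_mk] at h1
        convert h1 using 2
        rw [smul_add]
        abel)
      map_smul' := fun k f => huniq _ _ (by
        have h1 := T.graph.smul_mem k (hr f)
        rw [Prod.smul_mk] at h1
        rwa [smul_add, smul_comm k z] at h1) }
  refine ⟨R.mkContinuous C hrC, fun f => ?_, fun u => ?_⟩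
  · obtain ⟨u, h1, h2⟩ := (LinearPMap.mem_graph_iff T).1 (hr f)
    simp only at h1 h2
    have h3 : R.mkContinuous C hrC f = u := h1.symm
    rw [h3]
    exact ⟨u.2, by rw [Subtype.coe_eta, h2, ← h1, add_sub_cancel_left]⟩
  · refine huniq _ _ ?_
    rw [add_sub_cancel]
    exact LinearPMap.mem_graph T u

end Resolvent

/-! ### Solving and uniqueness for the extension -/

section Extension

open Filter Topology

variable {H : Type*} [NormedAddCommGroup H]

theorem norm_sq_eq_integral {J : Set ℝ} [InnerProductSpace ℂ H] (u : L2On H J) :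
    ‖u‖ ^ 2 = ∫ t in J, ‖u t‖ ^ 2 := by
  have h1 : ((‖u‖ ^ 2 : ℝ) : ℂ) = ((∫ t in J, ‖u t‖ ^ 2 : ℝ) : ℂ) := by
    have h2 := L2.inner_def (𝕜 := ℂ) u u
    rw [inner_self_eq_norm_sq_to_K] at h2
    simp only [inner_self_eq_norm_sq_to_K] at h2
    rw [← integral_complex_ofReal]
    push_cast
    exact h2
  exact_mod_cast h1

theorem integral_norm_indicator_sq [InnerProductSpace ℂ H] {J : Set ℝ} (hJ : MeasurableSet J)
    (u : L2On H J) : ∫ t, ‖J.indicator u t‖ ^ 2 = ‖u‖ ^ 2 := by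
  rw [norm_sq_eq_integral, ← integral_indicator hJ]
  congr 1
  ext t
  by_cases h : t ∈ J
  · rw [indicator_of_mem h, indicator_of_mem h]
  · rw [indicator_of_notMem h, indicator_of_notMem h]
    simp

variable [InnerProductSpace ℂ H]

theorem weakDefect_add (z : ℂ) (φ : ℝ → ℝ) (x y : H) (u v : ℝ → H) (t : ℝ) :
    weakDefect z φ x y (fun t => u t + v t) t
      = weakDefect z φ x y u t + weakDefect z φ x y v t := by
  simp only [weakDefect, inner_add_right]
  ring

theorem integrable_weakDefect {φ : ℝ → ℝ} (hφ : ContDiff ℝ ∞ φ) (hs : HasCompactSupport φ)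
    {u : ℝ → H} (hu : Continuous u) (z : ℂ) (x y : H) : Integrable (weakDefect z φ x y u) := by
  refine (continuous_weakDefect hφ hu z x y).integrable_of_hasCompactSupport ?_
  exact (((hasCompactSupport_ofReal_mul hs.deriv _).mul_left).add
    (hasCompactSupport_ofReal_mul hs _)).sub (hasCompactSupport_ofReal_mul hs _).mul_left

theorem volterra_indicator {U : ℝ → H →L[ℂ] H} {z : ℂ} {J : Set ℝ} (hJ : MeasurableSet J) (f : ℝ → H) (t : ℝ) :
    volterra U z (J.indicator f) t = ((((SignType.sign z.im : ℤ) : ℝ) : ℂ) * Complex.I) •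
      ∫ s in {s | t - s ∈ decaySet z.im} ∩ J, kernel U z (t - s) (f s) := by
  rw [volterra, ← setIntegral_indicator hJ]
  congr 3
  ext s
  by_cases h : s ∈ J
  · rw [indicator_of_mem h, indicator_of_mem h]
  · rw [indicator_of_notMem h, indicator_of_notMem h, map_zero]

/-- Test functions supported in `J` do not see the rest of the line, so an identity on `ℝ` for a
continuous representative restricts to `J`. -/
theorem isWeakSolution_of_integral_weakDefect {A : H →ₗ.[ℂ] H} {z : ℂ}
    {J : Set ℝ} (hJ : IsOpen J) {u f : L2On H J} {v : ℝ → H}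
    (hv : Continuous v) (huv : u =ᵐ[volume.restrict J] v)
    (h : ∀ x y, (x, y) ∈ A.graph → ∀ φ : ℝ → ℝ, ContDiff ℝ ∞ φ → HasCompactSupport φ →
      ∫ t, weakDefect z φ x y v t = ∫ t, (φ t : ℂ) * ⟪x, J.indicator f t⟫_ℂ) :
    IsWeakSolution A J u (z • u + f) := by
  intro φ hφ hs hJφ x
  have hd : Continuous (deriv φ) := hφ.continuous_deriv (by simp)
  have h1 := h _ _ (LinearPMap.mem_graph A x) φ hφ hs
  rw [integral_mul_inner_add hφ.continuous hs, integral_mul_inner_smul φ,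
    setIntegral_mul_inner_eq hJ.measurableSet φ (x : H) f, ← h1,
    ← setIntegral_eq_integral_of_forall_compl_eq_zero (s := J)
      (f := weakDefect z φ (x : H) (A x) v)]
  · have hc : ∀ (c : ℝ → ℝ) (w : H), ∫ t in J, (c t : ℂ) * ⟪w, u t⟫_ℂ
        = ∫ t in J, (c t : ℂ) * ⟪w, v t⟫_ℂ := by
      intro c w
      apply integral_congr_ae
      filter_upwards [huv] with t ht
      rw [ht]
    have hi : ∀ (c : ℝ → ℝ) (w : H), Continuous c → HasCompactSupport c →
        Integrable (fun t => (c t : ℂ) * ⟪w, v t⟫_ℂ) (volume.restrict J) := by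
      intro c w hcc hcs
      have : Continuous fun t => (c t : ℂ) * ⟪w, v t⟫_ℂ := by fun_prop
      exact (this.integrable_of_hasCompactSupport (hasCompactSupport_ofReal_mul hcs _)).integrableOn
    rw [hc, hc, hc]
    unfold weakDefect
    rw [integral_sub, integral_add, integral_const_mul, integral_const_mul]
    · ring
    · exact (hi _ _ hd hs.deriv).const_mul _
    · exact hi _ _ hφ.continuous hs
    · exact ((hi _ _ hd hs.deriv).const_mul _).add (hi _ _ hφ.continuous hs)
    · exact (hi _ _ hφ.continuous hs).const_mul _
  · intro t ht
    have h2 : t ∉ tsupport φ := fun hm => ht (hJφ hm)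
    have h3 : φ t = 0 := image_eq_zero_of_notMem_tsupport h2
    have h4 : deriv φ t = 0 := image_eq_zero_of_notMem_tsupport fun hm =>
      h2 (closure_minimal (support_deriv_subset) (isClosed_tsupport φ) hm)
    simp [weakDefect, h3, h4]

variable [CompleteSpace H]
  {A : H →ₗ.[ℂ] H} {U : ℝ → H →L[ℂ] H} {z : ℂ} {J : Set ℝ}

theorem mem_extensionOp_graph (hA : Dense (A.domain : Set H)) {a b : ℝ} (W : H ≃ₗᵢ[ℂ] H)
    (u g : L2Sum H a b) :
    (u, g) ∈ (extensionOp A a b W).graph ↔ u ∈ boundarySpace a b W ∧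
      IsWeakSolution A (Iio a) u.fst g.fst ∧ IsWeakSolution A (Ioi b) u.snd g.snd := by
  rw [← mem_maxOp_graph hA isOpen_Iio, ← mem_maxOp_graph hA isOpen_Ioi]
  constructor
  · intro h
    obtain ⟨u', h1, h2⟩ := (LinearPMap.mem_graph_iff _).1 h
    simp only at h1 h2
    subst h1 h2
    have hu := u'.2
    exact ⟨hu.1, LinearPMap.mem_graph _ ⟨_, hu.2.1⟩, LinearPMap.mem_graph _ ⟨_, hu.2.2⟩⟩
  · rintro ⟨h1, h2, h3⟩
    obtain ⟨u₁, h4, h5⟩ := (LinearPMap.mem_graph_iff _).1 h2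
    obtain ⟨u₂, h6, h7⟩ := (LinearPMap.mem_graph_iff _).1 h3
    simp only at h4 h5 h6 h7
    have hd1 : u.fst ∈ (maxOp A (Iio a)).domain := h4 ▸ u₁.2
    have hd2 : u.snd ∈ (maxOp A (Ioi b)).domain := h6 ▸ u₂.2
    have hd : u ∈ (extensionOp A a b W).domain := ⟨h1, hd1, hd2⟩
    rw [LinearPMap.mem_graph_iff]
    refine ⟨⟨u, hd⟩, rfl, ?_⟩
    have e1 : u₁ = ⟨u.fst, hd1⟩ := Subtype.ext h4
    have e2 : u₂ = ⟨u.snd, hd2⟩ := Subtype.ext h6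
    change WithLp.toLp 2 (maxOp A (Iio a) ⟨u.fst, hd1⟩, maxOp A (Ioi b) ⟨u.snd, hd2⟩) = g
    rw [← e1, ← e2, h5, h7]
    rfl

theorem continuous_kernel_add_volterra (hU : IsExpGroup A U) (hz : z.im ≠ 0)
    (hJ : MeasurableSet J) (c : H) (t₀ : ℝ) (f : L2On H J) :
    Continuous fun t => kernel U z (t - t₀) c + volterra U z (J.indicator f) t :=
  ((hU.continuous_kernel z c).comp (continuous_id.sub continuous_const)).add
    (continuous_volterra hU hz (memLp_indicator_coe hJ f))

theorem isWeakSolution_kernel_add_volterra (hU : IsExpGroup A U) (hz : z.im ≠ 0) (hJ : IsOpen J)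
    (c : H) (t₀ : ℝ) {u f : L2On H J} (hu : u =ᵐ[volume.restrict J]
      fun t => kernel U z (t - t₀) c + volterra U z (J.indicator f) t) :
    IsWeakSolution A J u (z • u + f) := by
  have hF := memLp_indicator_coe hJ.measurableSet f
  refine isWeakSolution_of_integral_weakDefect hJ
    (continuous_kernel_add_volterra hU hz hJ.measurableSet c t₀ f) hu fun x y hxy φ hφ hs => ?_
  simp only [weakDefect_add]
  rw [integral_add, integral_weakDefect_kernel hU z hxy hφ hs,
    integral_weakDefect_volterra hU hz hF hxy hφ hs, zero_add]
  · exact integrable_weakDefect hφ hs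
      ((hU.continuous_kernel z c).comp (continuous_id.sub continuous_const)) z x y
  · exact integrable_weakDefect hφ hs (continuous_volterra hU hz hF) z x y

theorem memLp_kernel_decaySet (hU : IsExpGroup A U) (hz : z.im ≠ 0) (c : H) (t₀ : ℝ) :
    MemLp (fun t => kernel U z (t - t₀) c) 2 (volume.restrict {t | t - t₀ ∈ decaySet z.im}) ∧
      ∫ t in {t | t - t₀ ∈ decaySet z.im}, ‖kernel U z (t - t₀) c‖ ^ 2
        = 1 / (2 * |z.im|) * ‖c‖ ^ 2 := by
  have hm : MeasurableSet {t | t - t₀ ∈ decaySet z.im} :=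
    (measurable_id.sub measurable_const) (measurableSet_decaySet _)
  have hc : Continuous fun t => kernel U z (t - t₀) c :=
    (hU.continuous_kernel z c).comp (continuous_id.sub continuous_const)
  have e : {t | t - t₀ ∈ decaySet z.im}.indicator (fun t => ‖kernel U z (t - t₀) c‖ ^ 2)
      = fun t => decay (2 * z.im) (t - t₀) * ‖c‖ ^ 2 := by
    ext t
    by_cases h : t - t₀ ∈ decaySet z.im
    · have h' : t ∈ {t | t - t₀ ∈ decaySet z.im} := h
      rw [indicator_of_mem h', hU.norm_kernel_apply, mul_pow, ← decay_sq, decay,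
        indicator_of_mem h]
    · have h' : t ∉ {t | t - t₀ ∈ decaySet z.im} := h
      rw [indicator_of_notMem h', ← decay_sq, decay, indicator_of_notMem h]
      simp
  have h2 : 2 * z.im ≠ 0 := by simpa using hz
  constructor
  · rw [memLp_two_iff_integrable_sq_norm hc.aestronglyMeasurable, ← IntegrableOn,
      ← integrable_indicator_iff hm, e]
    exact ((integrable_decay h2).comp_sub_right t₀).mul_const _
  · rw [← integral_indicator hm, e, integral_mul_const, integral_sub_right_eq_self (decay _),
      integral_decay h2, abs_mul, abs_two]

theorem integrableOn_kernel_inter (hU : IsExpGroup A U) (hz : z.im ≠ 0) (hJ : MeasurableSet J)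
    (f : L2On H J) (t : ℝ) :
    IntegrableOn (fun s => kernel U z (t - s) (f s)) ({s | t - s ∈ decaySet z.im} ∩ J) := by
  have h := (integrableOn_kernel hU hz (memLp_indicator_coe hJ f) t).mono_set
    (inter_subset_left (t := J))
  refine h.congr_fun (fun s hs => ?_) ((measurableSet_setOf_sub_mem_decaySet _ _).inter hJ)
  simp only
  rw [indicator_of_mem hs.2]

theorem memLp_of_eqOn_volterra (hU : IsExpGroup A U) (hz : z.im ≠ 0) (hJ : MeasurableSet J)
    (f : L2On H J) {G : ℝ → H} (hG : EqOn G (volterra U z (J.indicator f)) J) :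
    MemLp G 2 (volume.restrict J) ∧
      ∫ t in J, ‖G t‖ ^ 2 ≤ 1 / |z.im| ^ 2 * ‖f‖ ^ 2 := by
  have hF := memLp_indicator_coe hJ f
  have hv := memLp_volterra hU hz hF
  have hae : G =ᵐ[volume.restrict J] volterra U z (J.indicator f) :=
    (ae_restrict_mem hJ).mono hG
  refine ⟨(memLp_congr_ae hae).2 (hv.restrict J), ?_⟩
  calc ∫ t in J, ‖G t‖ ^ 2 = ∫ t in J, ‖volterra U z (J.indicator f) t‖ ^ 2 :=
        setIntegral_congr_fun hJ fun t ht => by rw [hG ht]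
    _ ≤ ∫ t, ‖volterra U z (J.indicator f) t‖ ^ 2 :=
        setIntegral_le_integral (integrable_norm_sq hv) (ae_of_all _ fun t => sq_nonneg _)
    _ ≤ _ := by
        have := integral_norm_volterra_sq_le hU hz hF
        rwa [integral_norm_indicator_sq hJ] at this

theorem norm_volterra_indicator_sq_le (hU : IsExpGroup A U) (hz : z.im ≠ 0)
    (hJ : MeasurableSet J) (f : L2On H J) (t : ℝ) :
    ‖volterra U z (J.indicator f) t‖ ^ 2 ≤ 1 / (2 * |z.im|) * ‖f‖ ^ 2 := by
  have := norm_volterra_sq_le hU hz (memLp_indicator_coe hJ f) t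
  rwa [integral_norm_indicator_sq hJ] at this

theorem norm_sq_le_of_ae_eq_kernel_add_volterra (hU : IsExpGroup A U) (hz : z.im ≠ 0)
    (hJ : MeasurableSet J) (c : H) (t₀ : ℝ) {u f : L2On H J}
    (hc : MemLp (fun t => kernel U z (t - t₀) c) 2 (volume.restrict J))
    (hu : u =ᵐ[volume.restrict J]
      fun t => kernel U z (t - t₀) c + volterra U z (J.indicator f) t) :
    ‖u‖ ^ 2 ≤ 2 * (∫ t in J, ‖kernel U z (t - t₀) c‖ ^ 2) + 2 / |z.im| ^ 2 * ‖f‖ ^ 2 := by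
  obtain ⟨h1, h2⟩ := memLp_of_eqOn_volterra hU hz hJ f (eqOn_refl _ _)
  have hi1 : Integrable (fun t => ‖kernel U z (t - t₀) c‖ ^ 2) (volume.restrict J) :=
    hc.integrable_norm_pow (by norm_num)
  have hi2 : Integrable (fun t => ‖volterra U z (J.indicator f) t‖ ^ 2) (volume.restrict J) :=
    h1.integrable_norm_pow (by norm_num)
  calc ‖u‖ ^ 2 = ∫ t in J, ‖u t‖ ^ 2 := norm_sq_eq_integral u
    _ ≤ ∫ t in J, (2 * ‖kernel U z (t - t₀) c‖ ^ 2
          + 2 * ‖volterra U z (J.indicator f) t‖ ^ 2) := by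
        refine integral_mono_ae ((Lp.memLp u).integrable_norm_pow (by norm_num))
          ((hi1.const_mul 2).add (hi2.const_mul 2)) ?_
        filter_upwards [hu] with t ht
        rw [ht]
        have h3 := norm_add_le (kernel U z (t - t₀) c) (volterra U z (J.indicator f) t)
        have h4 := pow_le_pow_left₀ (norm_nonneg _) h3 2
        nlinarith [sq_nonneg (‖kernel U z (t - t₀) c‖ - ‖volterra U z (J.indicator f) t‖)]
    _ = 2 * (∫ t in J, ‖kernel U z (t - t₀) c‖ ^ 2)
          + 2 * ∫ t in J, ‖volterra U z (J.indicator f) t‖ ^ 2 := by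
        rw [integral_add (hi1.const_mul 2) (hi2.const_mul 2), integral_const_mul,
          integral_const_mul]
    _ ≤ _ := by
        have e : 2 / |z.im| ^ 2 * ‖f‖ ^ 2 = 2 * (1 / |z.im| ^ 2 * ‖f‖ ^ 2) := by ring
        rw [e]
        linarith

/-- Existence of a solution of `(L_W - z) u = f` from a solution of the boundary equation. -/
theorem exists_mem_extensionOp_graph (hU : IsExpGroup A U) (hA : Dense (A.domain : Set H))
    (hz : z.im ≠ 0) {a b : ℝ} (W : H ≃ₗᵢ[ℂ] H) (f : L2Sum H a b) (c₁ c₂ : H)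
    (h₁ : MemLp (fun t => kernel U z (t - a) c₁) 2 (volume.restrict (Iio a)))
    (h₂ : MemLp (fun t => kernel U z (t - b) c₂) 2 (volume.restrict (Ioi b)))
    (hbc : c₂ + volterra U z ((Ioi b).indicator f.snd) b
      = W (c₁ + volterra U z ((Iio a).indicator f.fst) a)) :
    ∃ u : L2Sum H a b, (u, z • u + f) ∈ (extensionOp A a b W).graph ∧
      (u.fst =ᵐ[volume.restrict (Iio a)] fun t =>
        kernel U z (t - a) c₁ + volterra U z ((Iio a).indicator f.fst) t) ∧
      (u.snd =ᵐ[volume.restrict (Ioi b)] fun t =>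
        kernel U z (t - b) c₂ + volterra U z ((Ioi b).indicator f.snd) t) := by
  have hm₁ := h₁.add (memLp_of_eqOn_volterra hU hz measurableSet_Iio f.fst (eqOn_refl _ _)).1
  have hm₂ := h₂.add (memLp_of_eqOn_volterra hU hz measurableSet_Ioi f.snd (eqOn_refl _ _)).1
  have e₁ := hm₁.coeFn_toLp
  have e₂ := hm₂.coeFn_toLp
  refine ⟨WithLp.toLp 2 (hm₁.toLp _, hm₂.toLp _), ?_, e₁, e₂⟩
  rw [mem_extensionOp_graph hA]
  refine ⟨⟨_, _, (continuous_kernel_add_volterra hU hz measurableSet_Iio c₁ a f.fst).continuousOn,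
    (continuous_kernel_add_volterra hU hz measurableSet_Ioi c₂ b f.snd).continuousOn, e₁, e₂, ?_⟩,
    isWeakSolution_kernel_add_volterra hU hz isOpen_Iio c₁ a e₁,
    isWeakSolution_kernel_add_volterra hU hz isOpen_Ioi c₂ b e₂⟩
  simp only [sub_self, hU.kernel_zero]
  exact hbc

/-- On the half line where the exponential does not decay, the norm is at least `e^{Im z · t₀} ‖c‖`,
and a positive constant is not square integrable on a set of infinite measure. -/
theorem eq_zero_of_memLp_kernel (hU : IsExpGroup A U) (hJ : MeasurableSet J)
    (hJv : volume J = ⊤) {t₀ : ℝ} (ht : ∀ t ∈ J, z.im * t₀ ≤ z.im * t) {c : H}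
    (hc : MemLp (fun t => kernel U z t c) 2 (volume.restrict J)) : c = 0 := by
  by_contra h
  have hi : IntegrableOn (fun t => ‖kernel U z t c‖ ^ 2) J := hc.integrable_norm_pow (by norm_num)
  have hpos : 0 < Real.exp (z.im * t₀) * ‖c‖ := mul_pos (Real.exp_pos _) (norm_pos_iff.2 h)
  have hconst : IntegrableOn (fun _ : ℝ => (Real.exp (z.im * t₀) * ‖c‖) ^ 2) J := by
    refine hi.mono' aestronglyMeasurable_const ?_
    filter_upwards [ae_restrict_mem hJ] with t htJ
    rw [Real.norm_eq_abs, abs_of_nonneg (sq_nonneg _), hU.norm_kernel_apply]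
    have := ht t htJ
    gcongr
  rw [integrableOn_const_iff] at hconst
  rcases hconst with h1 | h1
  · exact (pow_pos hpos 2).ne' (enorm_eq_zero.1 h1)
  · simp [hJv] at h1

/-- `L_W - z` is injective for nonreal `z`. -/
theorem eq_zero_of_mem_extensionOp_graph (hU : IsExpGroup A U) (hA : Dense (A.domain : Set H))
    (hz : z.im ≠ 0) {a b : ℝ} (W : H ≃ₗᵢ[ℂ] H) (u : L2Sum H a b)
    (h : (u, z • u) ∈ (extensionOp A a b W).graph) : u = 0 := by
  obtain ⟨⟨v₁, v₂, hv₁, hv₂, huv₁, huv₂, hbc⟩, hw₁, hw₂⟩ := (mem_extensionOp_graph hA W _ _).1 h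
  obtain ⟨c₁, hc₁⟩ := IsWeakSolution.exists_ae_eq_kernel hU hA isOpen_Iio ordConnected_Iio hw₁
  obtain ⟨c₂, hc₂⟩ := IsWeakSolution.exists_ae_eq_kernel hU hA isOpen_Ioi ordConnected_Ioi hw₂
  -- Almost everywhere equality of two functions continuous up to the end point extends to the end
  -- point.
  have e₁ : v₁ a = kernel U z a c₁ := by
    refine Measure.eqOn_of_ae_eq (μ := volume) (s := Iic a) ?_ hv₁
      (hU.continuous_kernel z c₁).continuousOn (by simp [closure_Iio]) (self_mem_Iic)
    rw [← restrict_Iio_eq_restrict_Iic]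
    exact huv₁.symm.trans hc₁
  have e₂ : v₂ b = kernel U z b c₂ := by
    refine Measure.eqOn_of_ae_eq (μ := volume) (s := Ici b) ?_ hv₂
      (hU.continuous_kernel z c₂).continuousOn (by simp [closure_Ioi]) (self_mem_Ici)
    rw [← restrict_Ioi_eq_restrict_Ici]
    exact huv₂.symm.trans hc₂
  have hk : ∀ t c, kernel U z t c = 0 → c = 0 := fun t c h => by
    rw [← hU.kernel_neg_kernel z t c, h, map_zero]
  rw [e₁, e₂] at hbc
  -- Square integrability kills the constant on the half line of growth; the boundary condition,
  -- with `W` and the kernel injective, kills the other one.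
  have hc : c₁ = 0 ∧ c₂ = 0 := by
    rcases hz.lt_or_gt with hl | hl
    · have h0 : c₁ = 0 := eq_zero_of_memLp_kernel hU measurableSet_Iio Real.volume_Iio (t₀ := a)
        (fun t ht => by have : t < a := ht; nlinarith) ((memLp_congr_ae hc₁).1 (Lp.memLp _))
      refine ⟨h0, hk b c₂ ?_⟩
      rw [hbc, h0, map_zero, map_zero]
    · have h0 : c₂ = 0 := eq_zero_of_memLp_kernel hU measurableSet_Ioi Real.volume_Ioi (t₀ := b)
        (fun t ht => by have : b < t := ht; nlinarith) ((memLp_congr_ae hc₂).1 (Lp.memLp _))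
      refine ⟨hk a c₁ (W.injective ?_), h0⟩
      rw [← hbc, h0, map_zero, map_zero]
  have z₁ : u.fst = 0 := by
    rw [Lp.eq_zero_iff_ae_eq_zero]
    filter_upwards [hc₁] with t ht
    rw [ht, hc.1, map_zero]
    rfl
  have z₂ : u.snd = 0 := by
    rw [Lp.eq_zero_iff_ae_eq_zero]
    filter_upwards [hc₂] with t ht
    rw [ht, hc.2, map_zero]
    rfl
  refine WithLp.ofLp_injective 2 (Prod.ext z₁ z₂)

end Extension

/-! ### Explicit solutions for each sign of `Im z` -/

section Solution

open Filter Topology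

variable {H : Type*} [NormedAddCommGroup H] [InnerProductSpace ℂ H] {U : ℝ → H →L[ℂ] H} {z : ℂ}

theorem volterra_indicator_Iio_of_pos (hz : 0 < z.im) (a : ℝ) (f : ℝ → H) (t : ℝ) :
    volterra U z ((Iio a).indicator f) t
      = Complex.I • ∫ s in Ioo t a, kernel U z (t - s) (f s) := by
  rw [volterra_indicator measurableSet_Iio, setOf_sub_mem_decaySet_of_pos hz, Ioi_inter_Iio]
  simp [hz]

theorem volterra_indicator_Ioi_of_pos (hz : 0 < z.im) {b : ℝ} (f : ℝ → H) {t : ℝ} (ht : b ≤ t) :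
    volterra U z ((Ioi b).indicator f) t
      = Complex.I • ∫ s in Ioi t, kernel U z (t - s) (f s) := by
  rw [volterra_indicator measurableSet_Ioi, setOf_sub_mem_decaySet_of_pos hz,
    inter_eq_left.2 (Ioi_subset_Ioi ht)]
  simp [hz]

theorem volterra_indicator_Iio_of_neg (hz : z.im < 0) {a : ℝ} (f : ℝ → H) {t : ℝ} (ht : t ≤ a) :
    volterra U z ((Iio a).indicator f) t
      = -Complex.I • ∫ s in Iio t, kernel U z (t - s) (f s) := by
  rw [volterra_indicator measurableSet_Iio, setOf_sub_mem_decaySet_of_neg hz,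
    inter_eq_left.2 (Iio_subset_Iio ht)]
  simp [hz]

theorem volterra_indicator_Ioi_of_neg (hz : z.im < 0) (b : ℝ) (f : ℝ → H) (t : ℝ) :
    volterra U z ((Ioi b).indicator f) t
      = -Complex.I • ∫ s in Ioo b t, kernel U z (t - s) (f s) := by
  rw [volterra_indicator measurableSet_Ioi, setOf_sub_mem_decaySet_of_neg hz, Iio_inter_Ioi]
  simp [hz]

theorem upperDatum_eq (hz : 0 < z.im) {a b : ℝ} (W : H ≃ₗᵢ[ℂ] H) (f : L2Sum H a b) :
    upperDatum U a b W z f = W.symm (volterra U z ((Ioi b).indicator f.snd) b) := by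
  rw [upperDatum, volterra_indicator_Ioi_of_pos hz _ le_rfl]

theorem lowerDatum_eq (hz : z.im < 0) {a b : ℝ} (W : H ≃ₗᵢ[ℂ] H) (f : L2Sum H a b) :
    lowerDatum U a b W z f = W (volterra U z ((Iio a).indicator f.fst) a) := by
  rw [lowerDatum, volterra_indicator_Iio_of_neg hz _ le_rfl]

theorem memLp_kernel_zero (z : ℂ) (t₀ : ℝ) (J : Set ℝ) :
    MemLp (fun t => kernel U z (t - t₀) (0 : H)) 2 (volume.restrict J) := by
  simp

variable [CompleteSpace H] {A : H →ₗ.[ℂ] H}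

theorem memLp_kernel_Iio (hU : IsExpGroup A U) (hz : 0 < z.im) (c : H) (a : ℝ) :
    MemLp (fun t => kernel U z (t - a) c) 2 (volume.restrict (Iio a)) ∧
      ∫ t in Iio a, ‖kernel U z (t - a) c‖ ^ 2 = 1 / (2 * |z.im|) * ‖c‖ ^ 2 := by
  have := memLp_kernel_decaySet hU hz.ne' c a
  rwa [setOf_sub_mem_decaySet_of_pos' hz] at this

theorem memLp_kernel_Ioi (hU : IsExpGroup A U) (hz : z.im < 0) (c : H) (b : ℝ) :
    MemLp (fun t => kernel U z (t - b) c) 2 (volume.restrict (Ioi b)) ∧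
      ∫ t in Ioi b, ‖kernel U z (t - b) c‖ ^ 2 = 1 / (2 * |z.im|) * ‖c‖ ^ 2 := by
  have := memLp_kernel_decaySet hU hz.ne c b
  rwa [setOf_sub_mem_decaySet_of_neg' hz] at this

theorem norm_upperDatum_sq_le (hU : IsExpGroup A U) (hz : 0 < z.im) {a b : ℝ} (W : H ≃ₗᵢ[ℂ] H)
    (f : L2Sum H a b) :
    ‖upperDatum U a b W z f‖ ^ 2 ≤ 1 / (2 * |z.im|) * ‖f.snd‖ ^ 2 := by
  rw [upperDatum_eq hz, LinearIsometryEquiv.norm_map]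
  exact norm_volterra_indicator_sq_le hU hz.ne' measurableSet_Ioi f.snd b

theorem norm_lowerDatum_sq_le (hU : IsExpGroup A U) (hz : z.im < 0) {a b : ℝ} (W : H ≃ₗᵢ[ℂ] H)
    (f : L2Sum H a b) :
    ‖lowerDatum U a b W z f‖ ^ 2 ≤ 1 / (2 * |z.im|) * ‖f.fst‖ ^ 2 := by
  rw [lowerDatum_eq hz, LinearIsometryEquiv.norm_map]
  exact norm_volterra_indicator_sq_le hU hz.ne measurableSet_Iio f.fst a

/-- The homogeneous parts contribute `2 · 1/4` and the integral parts `2` to the coefficient of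
`‖f‖² / |Im z|²`; `5/2` is rounded up to `9 = 3²`. -/
theorem norm_le_of_ae_eq (hU : IsExpGroup A U) (hz : z.im ≠ 0) {a b : ℝ} {u f : L2Sum H a b}
    {c₁ c₂ : H}
    (h₁ : MemLp (fun t => kernel U z (t - a) c₁) 2 (volume.restrict (Iio a)))
    (h₂ : MemLp (fun t => kernel U z (t - b) c₂) 2 (volume.restrict (Ioi b)))
    (hu₁ : u.fst =ᵐ[volume.restrict (Iio a)] fun t =>
      kernel U z (t - a) c₁ + volterra U z ((Iio a).indicator f.fst) t)
    (hu₂ : u.snd =ᵐ[volume.restrict (Ioi b)] fun t =>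
      kernel U z (t - b) c₂ + volterra U z ((Ioi b).indicator f.snd) t)
    (hc : (∫ t in Iio a, ‖kernel U z (t - a) c₁‖ ^ 2) + ∫ t in Ioi b, ‖kernel U z (t - b) c₂‖ ^ 2
      ≤ 1 / (4 * |z.im| ^ 2) * ‖f‖ ^ 2) :
    ‖u‖ ≤ 3 / |z.im| * ‖f‖ := by
  have e₁ := norm_sq_le_of_ae_eq_kernel_add_volterra hU hz measurableSet_Iio c₁ a h₁ hu₁
  have e₂ := norm_sq_le_of_ae_eq_kernel_add_volterra hU hz measurableSet_Ioi c₂ b h₂ hu₂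
  have hf := WithLp.prod_norm_sq_eq_of_L2 f
  have hu := WithLp.prod_norm_sq_eq_of_L2 u
  apply le_of_sq_le_sq _ (by positivity)
  have hp : 0 ≤ 1 / |z.im| ^ 2 * ‖f‖ ^ 2 := by positivity
  have r1 : 1 / (4 * |z.im| ^ 2) * ‖f‖ ^ 2 = 1 / 4 * (1 / |z.im| ^ 2 * ‖f‖ ^ 2) := by
    field_simp
  have r2 : (3 / |z.im| * ‖f‖) ^ 2 = 9 * (1 / |z.im| ^ 2 * ‖f‖ ^ 2) := by
    ring
  have r3 : 2 / |z.im| ^ 2 * ‖f.fst‖ ^ 2 + 2 / |z.im| ^ 2 * ‖f.snd‖ ^ 2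
      = 2 * (1 / |z.im| ^ 2 * ‖f‖ ^ 2) := by
    rw [hf]; ring
  rw [r2, hu]
  rw [r1] at hc
  linarith

/-- The solution of `(L_W - z) u = f` for `Im z > 0`. -/
theorem exists_solution_of_pos (hU : IsExpGroup A U) (hA : Dense (A.domain : Set H))
    (hz : 0 < z.im) {a b : ℝ} (W : H ≃ₗᵢ[ℂ] H) (f : L2Sum H a b) :
    ∃ u : L2Sum H a b, (u, z • u + f) ∈ (extensionOp A a b W).graph ∧ ‖u‖ ≤ 3 / |z.im| * ‖f‖ ∧
      (u.fst =ᵐ[volume.restrict (Iio a)] fun t => kernel U z (t - a) (upperDatum U a b W z f)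
        + Complex.I • ∫ s in Ioo t a, kernel U z (t - s) (f.fst s)) ∧
      (u.snd =ᵐ[volume.restrict (Ioi b)] fun t =>
        Complex.I • ∫ s in Ioi t, kernel U z (t - s) (f.snd s)) := by
  obtain ⟨hm, hi⟩ := memLp_kernel_Iio hU hz (upperDatum U a b W z f) a
  -- No homogeneous part is allowed on `(b, ∞)`. At `a` the integral over `Ioo a a` vanishes, so the
  -- boundary condition prescribes `W c₁` as the value of the second component at `b`.
  obtain ⟨u, hu, hu₁, hu₂⟩ := exists_mem_extensionOp_graph hU hA hz.ne' W f
    (upperDatum U a b W z f) 0 hm (memLp_kernel_zero z b _) (by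
      rw [volterra_indicator_Iio_of_pos hz, Ioo_self, upperDatum_eq hz]
      simp)
  refine ⟨u, hu, norm_le_of_ae_eq hU hz.ne' hm (memLp_kernel_zero z b _) hu₁ hu₂ ?_, ?_, ?_⟩
  · have h1 := norm_upperDatum_sq_le hU hz W f
    have h2 : ‖f.snd‖ ^ 2 ≤ ‖f‖ ^ 2 := by
      rw [WithLp.prod_norm_sq_eq_of_L2 f]; nlinarith [sq_nonneg ‖f.fst‖]
    rw [hi]
    simp only [map_zero, norm_zero, ne_eq, OfNat.ofNat_ne_zero, not_false_eq_true, zero_pow,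
      integral_zero, add_zero]
    calc 1 / (2 * |z.im|) * ‖upperDatum U a b W z f‖ ^ 2
        ≤ 1 / (2 * |z.im|) * (1 / (2 * |z.im|) * ‖f‖ ^ 2) := by
          gcongr
          exact h1.trans (by gcongr)
      _ = _ := by ring
  · filter_upwards [hu₁] with t ht
    rw [ht, volterra_indicator_Iio_of_pos hz]
  · filter_upwards [hu₂, ae_restrict_mem measurableSet_Ioi] with t ht hb
    rw [ht, map_zero, zero_add, volterra_indicator_Ioi_of_pos hz _ (le_of_lt hb)]

/-- The solution of `(L_W - z) u = f` for `Im z < 0`. -/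
theorem exists_solution_of_neg (hU : IsExpGroup A U) (hA : Dense (A.domain : Set H))
    (hz : z.im < 0) {a b : ℝ} (W : H ≃ₗᵢ[ℂ] H) (f : L2Sum H a b) :
    ∃ u : L2Sum H a b, (u, z • u + f) ∈ (extensionOp A a b W).graph ∧ ‖u‖ ≤ 3 / |z.im| * ‖f‖ ∧
      (u.fst =ᵐ[volume.restrict (Iio a)] fun t =>
        -Complex.I • ∫ s in Iio t, kernel U z (t - s) (f.fst s)) ∧
      (u.snd =ᵐ[volume.restrict (Ioi b)] fun t => kernel U z (t - b) (lowerDatum U a b W z f)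
        - Complex.I • ∫ s in Ioo b t, kernel U z (t - s) (f.snd s)) := by
  obtain ⟨hm, hi⟩ := memLp_kernel_Ioi hU hz (lowerDatum U a b W z f) b
  -- The mirror image: no homogeneous part on `(-∞, a)`, and the integral part of the second
  -- component vanishes at `b`.
  obtain ⟨u, hu, hu₁, hu₂⟩ := exists_mem_extensionOp_graph hU hA hz.ne W f
    0 (lowerDatum U a b W z f) (memLp_kernel_zero z a _) hm (by
      rw [volterra_indicator_Ioi_of_neg hz, Ioo_self, lowerDatum_eq hz]
      simp)
  refine ⟨u, hu, norm_le_of_ae_eq hU hz.ne (memLp_kernel_zero z a _) hm hu₁ hu₂ ?_, ?_, ?_⟩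
  · have h1 := norm_lowerDatum_sq_le hU hz W f
    have h2 : ‖f.fst‖ ^ 2 ≤ ‖f‖ ^ 2 := by
      rw [WithLp.prod_norm_sq_eq_of_L2 f]; nlinarith [sq_nonneg ‖f.snd‖]
    rw [hi]
    simp only [map_zero, norm_zero, ne_eq, OfNat.ofNat_ne_zero, not_false_eq_true, zero_pow,
      integral_zero, zero_add]
    calc 1 / (2 * |z.im|) * ‖lowerDatum U a b W z f‖ ^ 2
        ≤ 1 / (2 * |z.im|) * (1 / (2 * |z.im|) * ‖f‖ ^ 2) := by
          gcongr
          exact h1.trans (by gcongr)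
      _ = _ := by ring
  · filter_upwards [hu₁, ae_restrict_mem measurableSet_Iio] with t ht hb
    rw [ht, map_zero, zero_add, volterra_indicator_Iio_of_neg hz _ (le_of_lt hb)]
  · filter_upwards [hu₂] with t ht
    rw [ht, volterra_indicator_Ioi_of_neg hz, neg_smul, ← sub_eq_add_neg]

theorem nonreal_subset_resolventSet (hU : IsExpGroup A U) (hA : Dense (A.domain : Set H))
    (a b : ℝ) (W : H ≃ₗᵢ[ℂ] H) :
    {z : ℂ | z.im ≠ 0} ⊆ resolventSet (extensionOp A a b W) := by
  intro z hz
  have hz' : z.im ≠ 0 := hz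
  refine exists_isResolventAt (3 / |z.im|)
    (eq_zero_of_mem_extensionOp_graph hU hA hz' W) fun f => ?_
  rcases hz'.lt_or_gt with h | h
  · obtain ⟨u, h1, h2, -⟩ := exists_solution_of_neg hU hA h W f
    exact ⟨u, h1, h2⟩
  · obtain ⟨u, h1, h2, -⟩ := exists_solution_of_pos hU hA h W f
    exact ⟨u, h1, h2⟩

end Solution

end

end SingularDiff

/-! ### The resolvent set, the resolvent formulas and their bounds -/

theorem theorem3p2 {H : Type*} [NormedAddCommGroup H] [InnerProductSpace ℂ H] [CompleteSpace H]
    [TopologicalSpace.SeparableSpace H] (A : H →ₗ.[ℂ] H) (hA : IsSelfAdjoint A)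
    (a b : ℝ) (hab : a < b) :
    (∀ W : H ≃ₗᵢ[ℂ] H,
      {z : ℂ | z.im ≠ 0} ⊆ SingularDiff.resolventSet (SingularDiff.extensionOp A a b W)) ∧
    ∃ U : ℝ → H →L[ℂ] H,
      SingularDiff.IsExpGroup A U ∧ (∀ V, SingularDiff.IsExpGroup A V → V = U) ∧
      ∀ (W : H ≃ₗᵢ[ℂ] H) (z : ℂ) (R : SingularDiff.L2Sum H a b →L[ℂ] SingularDiff.L2Sum H a b),
        SingularDiff.IsResolventAt (SingularDiff.extensionOp A a b W) z R →
        ∀ f : SingularDiff.L2Sum H a b,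
          (0 < z.im →
            -- the integrals converge absolutely
            (∀ t < a, IntegrableOn (fun s => SingularDiff.kernel U z (t - s) (f.fst s))
              (Ioo t a)) ∧
            (∀ t ≥ b, IntegrableOn (fun s => SingularDiff.kernel U z (t - s) (f.snd s))
              (Ioi t)) ∧
            -- the resolvent formulas
            (R f).fst =ᵐ[volume.restrict (Iio a)] (fun t =>
              SingularDiff.kernel U z (t - a) (SingularDiff.upperDatum U a b W z f)
                + Complex.I • ∫ s in Ioo t a, SingularDiff.kernel U z (t - s) (f.fst s)) ∧
            (R f).snd =ᵐ[volume.restrict (Ioi b)] (fun t =>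
              Complex.I • ∫ s in Ioi t, SingularDiff.kernel U z (t - s) (f.snd s)) ∧
            -- the bounds
            ‖SingularDiff.upperDatum U a b W z f‖ ^ 2 ≤ 1 / (2 * z.im) * ‖f.snd‖ ^ 2 ∧
            MemLp (fun t => SingularDiff.kernel U z (t - a)
              (SingularDiff.upperDatum U a b W z f)) 2 (volume.restrict (Iio a)) ∧
            (∫ t in Iio a, ‖SingularDiff.kernel U z (t - a)
                (SingularDiff.upperDatum U a b W z f)‖ ^ 2)
              = 1 / (2 * z.im) * ‖SingularDiff.upperDatum U a b W z f‖ ^ 2 ∧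
            MemLp (fun t => Complex.I • ∫ s in Ioo t a, SingularDiff.kernel U z (t - s) (f.fst s))
              2 (volume.restrict (Iio a)) ∧
            (∫ t in Iio a,
                ‖Complex.I • ∫ s in Ioo t a, SingularDiff.kernel U z (t - s) (f.fst s)‖ ^ 2)
              ≤ 1 / z.im ^ 2 * ‖f.fst‖ ^ 2 ∧
            MemLp (fun t => Complex.I • ∫ s in Ioi t, SingularDiff.kernel U z (t - s) (f.snd s))
              2 (volume.restrict (Ioi b)) ∧
            (∫ t in Ioi b,
                ‖Complex.I • ∫ s in Ioi t, SingularDiff.kernel U z (t - s) (f.snd s)‖ ^ 2)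
              ≤ 1 / z.im ^ 2 * ‖f.snd‖ ^ 2) ∧
          (z.im < 0 →
            -- the integrals converge absolutely
            (∀ t ≤ a, IntegrableOn (fun s => SingularDiff.kernel U z (t - s) (f.fst s))
              (Iio t)) ∧
            (∀ t > b, IntegrableOn (fun s => SingularDiff.kernel U z (t - s) (f.snd s))
              (Ioo b t)) ∧
            -- the resolvent formulas
            (R f).fst =ᵐ[volume.restrict (Iio a)] (fun t =>
              -Complex.I • ∫ s in Iio t, SingularDiff.kernel U z (t - s) (f.fst s)) ∧
            (R f).snd =ᵐ[volume.restrict (Ioi b)] (fun t =>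
              SingularDiff.kernel U z (t - b) (SingularDiff.lowerDatum U a b W z f)
                - Complex.I • ∫ s in Ioo b t, SingularDiff.kernel U z (t - s) (f.snd s)) ∧
            -- the bounds
            MemLp (fun t => -Complex.I • ∫ s in Iio t, SingularDiff.kernel U z (t - s) (f.fst s))
              2 (volume.restrict (Iio a)) ∧
            (∫ t in Iio a,
                ‖-Complex.I • ∫ s in Iio t, SingularDiff.kernel U z (t - s) (f.fst s)‖ ^ 2)
              ≤ 1 / |z.im| ^ 2 * ‖f.fst‖ ^ 2 ∧
            ‖SingularDiff.lowerDatum U a b W z f‖ ^ 2 ≤ 1 / (2 * |z.im|) * ‖f.fst‖ ^ 2 ∧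
            MemLp (fun t => SingularDiff.kernel U z (t - b)
              (SingularDiff.lowerDatum U a b W z f)) 2 (volume.restrict (Ioi b)) ∧
            (∫ t in Ioi b, ‖SingularDiff.kernel U z (t - b)
                (SingularDiff.lowerDatum U a b W z f)‖ ^ 2)
              = 1 / (2 * |z.im|) * ‖SingularDiff.lowerDatum U a b W z f‖ ^ 2 ∧
            (∫ t in Ioi b, ‖SingularDiff.kernel U z (t - b)
                (SingularDiff.lowerDatum U a b W z f)‖ ^ 2)
              ≤ 1 / (4 * |z.im| ^ 2) * ‖f.fst‖ ^ 2 ∧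
            MemLp (fun t => -Complex.I • ∫ s in Ioo b t, SingularDiff.kernel U z (t - s) (f.snd s))
              2 (volume.restrict (Ioi b)) ∧
            (∫ t in Ioi b,
                ‖-Complex.I • ∫ s in Ioo b t, SingularDiff.kernel U z (t - s) (f.snd s)‖ ^ 2)
              ≤ 1 / |z.im| ^ 2 * ‖f.snd‖ ^ 2) := by
  have hd := hA.dense_domain
  obtain ⟨U, hU⟩ := SingularDiff.exists_isExpGroup hA
  refine ⟨SingularDiff.nonreal_subset_resolventSet hU hd a b, U, hU,
    fun V hV => SingularDiff.IsExpGroup.apply_ext hU hV hd, fun W z R hR f => ⟨fun hz => ?_,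
      fun hz => ?_⟩⟩
  · obtain ⟨u, hu, -, hu₁, hu₂⟩ := SingularDiff.exists_solution_of_pos hU hd hz W f
    -- Whatever resolvent `R` is given, its value at `f` is the explicit solution.
    rw [hR.apply_eq hu]
    obtain ⟨hm, hi⟩ :=
      SingularDiff.memLp_kernel_Iio hU hz (SingularDiff.upperDatum U a b W z f) a
    have hn := SingularDiff.norm_upperDatum_sq_le hU hz W f
    obtain ⟨h1, h2⟩ := SingularDiff.memLp_of_eqOn_volterra hU hz.ne' measurableSet_Iio f.fst
      fun t _ => (SingularDiff.volterra_indicator_Iio_of_pos hz a f.fst t).symm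
    obtain ⟨h3, h4⟩ := SingularDiff.memLp_of_eqOn_volterra hU hz.ne' measurableSet_Ioi f.snd
      fun t ht => (SingularDiff.volterra_indicator_Ioi_of_pos hz f.snd (le_of_lt ht)).symm
    rw [abs_of_pos hz] at hi hn h2 h4
    refine ⟨fun t _ => ?_, fun t ht => ?_, hu₁, hu₂, hn, hm, hi, h1, h2, h3, h4⟩
    · have := SingularDiff.integrableOn_kernel_inter hU hz.ne' measurableSet_Iio f.fst t
      rwa [SingularDiff.setOf_sub_mem_decaySet_of_pos hz, Ioi_inter_Iio] at this
    · have := SingularDiff.integrableOn_kernel_inter hU hz.ne' measurableSet_Ioi f.snd t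
      rwa [SingularDiff.setOf_sub_mem_decaySet_of_pos hz,
        inter_eq_left.2 (Ioi_subset_Ioi ht)] at this
  · obtain ⟨u, hu, -, hu₁, hu₂⟩ := SingularDiff.exists_solution_of_neg hU hd hz W f
    rw [hR.apply_eq hu]
    obtain ⟨hm, hi⟩ :=
      SingularDiff.memLp_kernel_Ioi hU hz (SingularDiff.lowerDatum U a b W z f) b
    have hn := SingularDiff.norm_lowerDatum_sq_le hU hz W f
    obtain ⟨h1, h2⟩ := SingularDiff.memLp_of_eqOn_volterra hU hz.ne measurableSet_Iio f.fst
      fun t ht => (SingularDiff.volterra_indicator_Iio_of_neg hz f.fst (le_of_lt ht)).symm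
    obtain ⟨h3, h4⟩ := SingularDiff.memLp_of_eqOn_volterra hU hz.ne measurableSet_Ioi f.snd
      fun t _ => (SingularDiff.volterra_indicator_Ioi_of_neg hz b f.snd t).symm
    refine ⟨fun t ht => ?_, fun t _ => ?_, hu₁, hu₂, h1, h2, hn, hm, hi, ?_, h3, h4⟩
    · have := SingularDiff.integrableOn_kernel_inter hU hz.ne measurableSet_Iio f.fst t
      rwa [SingularDiff.setOf_sub_mem_decaySet_of_neg hz,
        inter_eq_left.2 (Iio_subset_Iio ht)] at this
    · have := SingularDiff.integrableOn_kernel_inter hU hz.ne measurableSet_Ioi f.snd t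
      rwa [SingularDiff.setOf_sub_mem_decaySet_of_neg hz, Iio_inter_Ioi] at this
    · rw [hi]
      calc 1 / (2 * |z.im|) * ‖SingularDiff.lowerDatum U a b W z f‖ ^ 2
          ≤ 1 / (2 * |z.im|) * (1 / (2 * |z.im|) * ‖f.fst‖ ^ 2) := by gcongr
        _ = 1 / (4 * |z.im| ^ 2) * ‖f.fst‖ ^ 2 := by ring
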